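/- Fix $k\ge 2$. An in-place $k$-d tree is an array $P[1..n]$, $n\ge 1$, of points of $\mathbb{R}^k$, read as a binary tree in which $P[1]$ is the root and $P[2t]$, $P[2t+1]$ (if they exist) are the left and right child of $P[t]$, such that for every node $t$ of level $\ell=\lfloor\log_2 t\rfloor$, with splitting coordinate $i=\ell \bmod k$ (coordinates numbered from $0$) and split value $c=P[t]_i$, all points $x$ in the left subtree of $t$ have $x_i\le c$ and all points $x$ in the right subtree have $x_i\ge c$. The cell of the root is $\mathbb{R}^k$; the cells of the left and right child of $t$ are the intersections of the cell of $t$ with $\{x_i\le c\}$ and $\{x_i\ge c\}$, respectively. A program is a finite list of unit-cost instructions on a random access machine without stack. It has read-only access to $n$, to the array $P$ (only to the point $P[t]$ at the node $t=\mathit{Current}$ whose number is held in a distinguished register) and to the query box $Q=\prod_{i}[\alpha_i,\beta_i]$ with $\alpha_i\le\beta_i$. Its memory consists of finitely many integer registers (constants, $+$, truncated $-$, $\times$, integer division, comparison) and of a $2k$-tuple of coordinate cells, one for each coordinate $i$ and each side (lower or upper), each of which is NULL or holds a coordinate of an input point; it can compare coordinates of $P[\mathit{Current}]$, endpoints of $Q$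 and tuple entries, and it can write the current point to a write-only output. Then there are a program for counting and a program for reporting, and a constant $C$ for each of them, depending only on $k$, such that for every $n\ge1$, every in-place $k$-d tree $P$ of $n$ points and every such $Q$, with $\mu=|\{j: P[j]\in Q\}|$: 1. the counting program halts after at most $C\,n^{1-1/k}$ steps with $\mu$ in its result register (in particular, in $O(\sqrt n)$ time for $k=2$); 2. the reporting program halts after at most $C\,(n^{1-1/k}+\mu)$ steps, having output each array element that lies in $Q$ exactly once and nothing else; 3. both use $O(1)$ extra workspace: the number of registers depends only on $k$, the integer registers hold at all times integers of at most $C(\lfloor\log_2 n\rfloor+1)$ bits, and there is no recursion stack; 4. instead of a recursion stack, both keep a $2k$-tuple of boundary split values: each program has a main loop whose head is reached, after at most $C(\lfloor\log_2 n\rfloor+1)$ steps, with $\mathit{Current}$ equal to the root. From each visit of the head the machine, after at least one and at most $C$ further steps, has halted or is at the head again with $\mathit{Current}$ unchanged or replaced by one of its children or its parent. At each visit of the head, $\mathit{Current}$ is a node of the tree, and for each coordinate $i$ and each side the tuple entry is non-NULL if and only if the corresponding boundary facet of the cell of $\mathit{Current}$ exists and intersects $Q$; if it is non-NULL, it is the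 corresponding boundary value of the cell of that ancestor of $\mathit{Current}$ (possibly $\mathit{Current}$ itself) which is closest to the root among those whose corresponding facet exists and intersects $Q$. -/

import Mathlib

namespace InPlaceKD

/-! ### The in-place k-d tree

An array `P` of `n` points of `ℝ^k`, indexed by `Fin n`, is read as a binary tree whose levels are
all full except possibly the last one, which is filled from the left: the nodes are numbered
`1, …, n`, node `t` is the array element number `t` (so `P ⟨t - 1, _⟩`), its parent is `t / 2`, its
children, if present, are `2 * t` and `2 * t + 1`, its level is `Nat.log 2 t`, and `v` lies in the
subtree of `u` iff `v / 2 ^ m = u` for some `m`. -/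

/-- The `k`-d tree property: a node `u` of level `l` splits at the coordinate `l mod k`; the left
subtree is on the negative side, the right subtree on the positive side. Ties are allowed on both
sides, so that every array of points can be arranged into such a tree. -/
def IsKDTree {k n : ℕ} (P : Fin n → Fin k → ℝ) : Prop :=
  ∀ (u v : Fin n) (i : Fin k) (m : ℕ), (i : ℕ) = Nat.log 2 ((u : ℕ) + 1) % k →
    (((v : ℕ) + 1) / 2 ^ m = 2 * ((u : ℕ) + 1) → P v i ≤ P u i) ∧
    (((v : ℕ) + 1) / 2 ^ m = 2 * ((u : ℕ) + 1) + 1 → P u i ≤ P v i)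

/-- The array element with node number `t ∈ {1, …, n}`, if there is one. -/
def node? (n t : ℕ) : Option (Fin n) :=
  if h : 1 ≤ t ∧ t ≤ n then some ⟨t - 1, by omega⟩ else none

/-- Coordinate `i` of the point stored at node `t`. -/
def coord? {k n : ℕ} (P : Fin n → Fin k → ℝ) (t : ℕ) (i : Fin k) : Option ℝ :=
  (node? n t).map fun j => P j i

/-- The two sides of a box in a given direction. -/
inductive Side where
  | lower
  | upper

open Classical in
/-- The boundary value of the cell of node `t` in direction `i` on side `s`; `none` if the cell is
unbounded there. The cell of the root is the whole space. The left child cuts the cell of its parent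
from above, the right child (an odd number) from below, at the split value of the parent. -/
noncomputable def cellBound {k n : ℕ} (P : Fin n → Fin k → ℝ) (t : ℕ) (i : Fin k) (s : Side) :
    Option ℝ :=
  if _h : t ≤ 1 then none
  else if (i : ℕ) = Nat.log 2 (t / 2) % k ∧ (s = Side.lower ↔ t % 2 = 1) then coord? P (t / 2) i
  else cellBound P (t / 2) i s
termination_by t
decreasing_by omega

/-- The (closed) cell of node `t`. -/
def cell {k n : ℕ} (P : Fin n → Fin k → ℝ) (t : ℕ) : Set (Fin k → ℝ) :=
  {x | ∀ i : Fin k, (∀ c, cellBound P t i Side.lower = some c → c ≤ x i) ∧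
    (∀ c, cellBound P t i Side.upper = some c → x i ≤ c)}

/-- The boundary facet of the cell of node `t` in direction `i` on side `s` exists and intersects
the query range `Q`. -/
def FaceMeets {k n : ℕ} (P : Fin n → Fin k → ℝ) (Q : Set (Fin k → ℝ)) (t : ℕ) (i : Fin k)
    (s : Side) : Prop :=
  ∃ c, cellBound P t i s = some c ∧ ∃ x ∈ cell P t, x i = c ∧ x ∈ Q

/-- The value `e` (`none` is NULL) is the correct tuple entry for direction `i` and side `s` at node
`t`: it is non-NULL iff the corresponding facet of the cell of `t` intersects `Q`, and then it
is the boundary value of the cell of the ancestor of `t` (possibly `t` itself) that is closest to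
the root among those whose corresponding facet intersects `Q`. -/
def IsBoundaryEntry {k n : ℕ} (P : Fin n → Fin k → ℝ) (Q : Set (Fin k → ℝ)) (t : ℕ) (i : Fin k)
    (s : Side) (e : Option ℝ) : Prop :=
  (e ≠ none ↔ FaceMeets P Q t i s) ∧
  ∀ c, e = some c → ∃ m : ℕ, cellBound P (t / 2 ^ m) i s = some c ∧
    FaceMeets P Q (t / 2 ^ m) i s ∧ ∀ m' > m, ¬ FaceMeets P Q (t / 2 ^ m') i s

/-! ### The machine model

A random access machine without stack and without writable array. A program has finitely many labels
and finitely many word registers (natural numbers). Its only memory for coordinates is a `2k`-tuple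
of cells, each of which is NULL or holds a coordinate of an input point. The array and the query
box are read-only, and a distinguished register `cur` holds the number of the node whose point can
be accessed. There is a write-only output. Every instruction costs one unit of time. -/

/-- Arithmetic on words; `sub` is truncated, `div` rounds down. -/
inductive WordOp where
  | add
  | sub
  | mul
  | div

def WordOp.eval : WordOp → ℕ → ℕ → ℕ
  | add, a, b => a + b
  | sub, a, b => a - b
  | mul, a, b => a * b
  | div, a, b => a / b

/-- What can be compared: the coordinates of the point at the current node, the endpoints of the
query box, the entries of the tuple. -/
inductive CoordArg (k : ℕ) where
  | point (i : Fin k)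
  | queryLower (i : Fin k)
  | queryUpper (i : Fin k)
  | entry (i : Fin k) (s : Side)

/-- Instructions over labels `Λ` and word registers `W`.
* `const r c next`: `r := c`.
* `size r next`: `r := n`, the number of points.
* `arith op r a b next`: `r := op a b`.
* `ifLe a b yes no`: branch on `a ≤ b` for words.
* `store i s next`: tuple entry `(i, s) :=` coordinate `i` of the point at the current node.
* `clear i s next`: tuple entry `(i, s) := NULL`.
* `ifNull i s yes no`: branch on tuple entry `(i, s)` being NULL.
* `ifCoordLe x y yes no`: branch on `x ≤ y` for coordinates (no, if one of them is missing).
* `emit next`: report the point at the current node.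
* `halt`. -/
inductive Instr (k : ℕ) (Λ W : Type) where
  | const (r : W) (c : ℕ) (next : Λ)
  | size (r : W) (next : Λ)
  | arith (op : WordOp) (r a b : W) (next : Λ)
  | ifLe (a b : W) (yes no : Λ)
  | store (i : Fin k) (s : Side) (next : Λ)
  | clear (i : Fin k) (s : Side) (next : Λ)
  | ifNull (i : Fin k) (s : Side) (yes no : Λ)
  | ifCoordLe (x y : CoordArg k) (yes no : Λ)
  | emit (next : Λ)
  | halt

/-- A program: finitely many labels and word registers, an initial label, a distinguished label
`head` (the head of the main loop), the register `cur` of the current node, the register `out` of a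
numerical result, and an instruction for each label. -/
structure Program (k : ℕ) where
  Λ : Type
  W : Type
  finite_labels : Finite Λ
  finite_registers : Finite W
  start : Λ
  head : Λ
  cur : W
  out : W
  instr : Λ → Instr k Λ W

/-- A configuration of a program that runs on an array of `n` points. -/
structure Config {k : ℕ} (M : Program k) (n : ℕ) where
  label : M.Λ
  reg : M.W → ℕ
  tuple : Fin k → Side → Option ℝ
  output : List (Fin n)

def CoordArg.eval {k n : ℕ} {M : Program k} (P : Fin n → Fin k → ℝ) (α β : Fin k → ℝ)
    (σ : Config M n) : CoordArg k → Option ℝ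
  | point i => coord? P (σ.reg M.cur) i
  | queryLower i => some (α i)
  | queryUpper i => some (β i)
  | entry i s => σ.tuple i s

open Classical in
/-- One step on the array `P` with the query box `∏ i, [α i, β i]`; a halted configuration
does not change. -/
noncomputable def Program.step {k n : ℕ} (M : Program k) (P : Fin n → Fin k → ℝ)
    (α β : Fin k → ℝ) (σ : Config M n) : Config M n :=
  match M.instr σ.label with
  | .const r c next => { σ with label := next, reg := Function.update σ.reg r c }
  | .size r next => { σ with label := next, reg := Function.update σ.reg r n }
  | .arith op r a b next =>
      { σ with label := next, reg := Function.update σ.reg r (op.eval (σ.reg a) (σ.reg b)) }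
  | .ifLe a b yes no => { σ with label := if σ.reg a ≤ σ.reg b then yes else no }
  | .store i s next =>
      { σ with
        label := next
        tuple := fun i' s' =>
          if i' = i ∧ s' = s then coord? P (σ.reg M.cur) i else σ.tuple i' s' }
  | .clear i s next =>
      { σ with
        label := next
        tuple := fun i' s' => if i' = i ∧ s' = s then none else σ.tuple i' s' }
  | .ifNull i s yes no => { σ with label := if σ.tuple i s = none then yes else no }
  | .ifCoordLe x y yes no =>
      { σ with
        label := if ∃ a b, x.eval P α β σ = some a ∧ y.eval P α β σ = some b ∧ a ≤ b
          then yes else no }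
  | .emit next =>
      { σ with label := next, output := σ.output ++ (node? n (σ.reg M.cur)).toList }
  | .halt => σ

/-- Initially all words are `0`, the tuple is all NULL, and nothing has been reported. -/
def Program.init {k : ℕ} (M : Program k) (n : ℕ) : Config M n where
  label := M.start
  reg := fun _ => 0
  tuple := fun _ _ => none
  output := []

/-- The configuration after `T` steps. -/
noncomputable def Program.run {k n : ℕ} (M : Program k) (P : Fin n → Fin k → ℝ)
    (α β : Fin k → ℝ) (T : ℕ) : Config M n :=
  (M.step P α β)^[T] (M.init n)

def Config.Halted {k n : ℕ} {M : Program k} (σ : Config M n) : Prop :=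
  M.instr σ.label = Instr.halt

/-- The registers are machine words: throughout the run they have `O(log n)` bits. -/
def Program.SmallWords {k n : ℕ} (M : Program k) (P : Fin n → Fin k → ℝ) (α β : Fin k → ℝ)
    (C : ℕ) : Prop :=
  ∀ (T : ℕ) (r : M.W), Nat.size ((M.run P α β T).reg r) ≤ C * (Nat.log 2 n + 1)

/-- The run is a walk in the tree that keeps the `2k`-tuple of boundary split values: after an
initial phase of `O(log n)` steps the head of the main loop is reached with the root as current
node; from each visit of the head, after at most `C` further steps the machine has halted or is at
the head again, with the same current node, a child of it, or its parent; and at each visit of the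
head the tuple has the correct entries for the current node. -/
def Program.TracksTuple {k n : ℕ} (M : Program k) (P : Fin n → Fin k → ℝ) (α β : Fin k → ℝ)
    (C : ℕ) : Prop :=
  (∃ T ≤ C * (Nat.log 2 n + 1), (M.run P α β T).label = M.head ∧
    (M.run P α β T).reg M.cur = 1) ∧
  ∀ T : ℕ, (M.run P α β T).label = M.head →
    (1 ≤ (M.run P α β T).reg M.cur ∧ (M.run P α β T).reg M.cur ≤ n) ∧
    (∀ (i : Fin k) (s : Side), IsBoundaryEntry P (Set.Icc α β) ((M.run P α β T).reg M.cur) i s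
      ((M.run P α β T).tuple i s)) ∧
    ∃ d : ℕ, 1 ≤ d ∧ d ≤ C ∧
      ((M.run P α β (T + d)).Halted ∨
        ((M.run P α β (T + d)).label = M.head ∧
          ((M.run P α β (T + d)).reg M.cur = (M.run P α β T).reg M.cur ∨
            (M.run P α β (T + d)).reg M.cur = 2 * (M.run P α β T).reg M.cur ∨
            (M.run P α β (T + d)).reg M.cur = 2 * (M.run P α β T).reg M.cur + 1 ∨
            (M.run P α β (T + d)).reg M.cur = (M.run P α β T).reg M.cur / 2)))

/-- The number of array elements that lie in the box `∏ i, [α i, β i]`. -/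
noncomputable def rangeCount {k n : ℕ} (P : Fin n → Fin k → ℝ) (α β : Fin k → ℝ) : ℕ :=
  Nat.card {j : Fin n // P j ∈ Set.Icc α β}

end InPlaceKD

/-! A depth-first search of the implicit tree needs no stack: the parity of the node that is left
tells which child has been finished (`Walk.ascend`), and a register with the level gives the
splitting coordinate. What must be restored on the way up is the tuple. As long as the search stays
in cells that meet `Q`, a facet that has begun to meet `Q` continues to do so (`InBand.child`). So
the nodes on the path from the root whose facet `(i, s)` meets `Q` form a final segment of that
path, and the correct entry is the boundary value at the first of them. The register `dep i s` holds
the number of this node (`origin`, `origin_spec`). An entry is written on entering that node, is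
left alone below it, and is erased when the node is left; `origin_child_cases` shows that ascending
undoes descending. Because the cell of a node contains the point of the node, whether a facet meets
`Q` depends on one coordinate only (`faceMeets_iff`), so each round takes a bounded number of steps.

The results are right because a child that is skipped has no point of `Q` below it
(`IsKDTree.not_inRange`), and because a cell all of whose `2k` facets meet `Q` is contained in `Q`.
In the latter case the counting program adds the size of the subtree, which has a closed form
(`card_subtree_aux`). `Walk.traverse` combines these facts.

For the running time, a node whose cell meets `Q` and has a facet that misses `Q` has a cell that
crosses one of the `2k` hyperplanes bounding `Q` (`exists_crosses`). From one level to the next the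
number of cells crossing a fixed hyperplane at most doubles, and it does not grow when the level
splits in the direction of the hyperplane, which happens on one level out of every `k`
(`card_crosses_level`). Level `l` thus has at most `2 ^ (l - l / k)` such cells, and the geometric
sum is of order `n ^ (1 - 1/k)` (`exists_crossBound_le`). When reporting, every other visited node
is itself a hit; when counting, every visited node except the root is a child of a crossing node.

The programs are written as loop bodies without inner loops. The head label occurs only at the start
of a body, so an invariant of the bodies controls the whole run (`LoopProgram.run_invariant`). It
also bounds the words: they are small at the start of a body, and a body is too short to enlarge
them by more than a constant factor in bits. -/

namespace InPlaceKD

/-! ### Structured programs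

A loop program has finitely many loop bodies, each of which is a tree of instructions whose leaves
jump to the start of a loop body or halt. -/

/-- Trees of instructions. -/
inductive Code (k : ℕ) (L W : Type) where
  | const (r : W) (c : ℕ) (next : Code k L W)
  | size (r : W) (next : Code k L W)
  | arith (op : WordOp) (r a b : W) (next : Code k L W)
  | ifLe (a b : W) (yes no : Code k L W)
  | store (i : Fin k) (s : Side) (next : Code k L W)
  | clear (i : Fin k) (s : Side) (next : Code k L W)
  | ifNull (i : Fin k) (s : Side) (yes no : Code k L W)
  | ifCoordLe (x y : CoordArg k) (yes no : Code k L W)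
  | emit (next : Code k L W)
  | goto (l : L)
  | halt

/-- A configuration without its label. -/
@[ext]
structure Store (k n : ℕ) (W : Type) where
  reg : W → ℕ
  tuple : Fin k → Side → Option ℝ
  output : List (Fin n)

/-- The value of a coordinate argument in a store. -/
def Store.coord {k n : ℕ} {W : Type} (cur : W) (P : Fin n → Fin k → ℝ) (α β : Fin k → ℝ)
    (σ : Store k n W) : CoordArg k → Option ℝ
  | .point i => coord? P (σ.reg cur) i
  | .queryLower i => some (α i)
  | .queryUpper i => some (β i)
  | .entry i s => σ.tuple i s

namespace Code

variable {k n : ℕ} {L W : Type}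

/-- The first instruction of a tree changes the store and passes to a subtree. -/
noncomputable def small (cur : W) (P : Fin n → Fin k → ℝ) (α β : Fin k → ℝ) :
    Code k L W → Store k n W → Code k L W × Store k n W :=
  open Classical in fun c σ => match c with
  | const r c next => (next, { σ with reg := Function.update σ.reg r c })
  | size r next => (next, { σ with reg := Function.update σ.reg r n })
  | arith op r a b next =>
      (next, { σ with reg := Function.update σ.reg r (op.eval (σ.reg a) (σ.reg b)) })
  | ifLe a b yes no => (if σ.reg a ≤ σ.reg b then yes else no, σ)
  | store i s next =>
      (next, { σ with
        tuple := fun i' s' =>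
          if i' = i ∧ s' = s then coord? P (σ.reg cur) i else σ.tuple i' s' })
  | clear i s next =>
      (next, { σ with tuple := fun i' s' => if i' = i ∧ s' = s then none else σ.tuple i' s' })
  | ifNull i s yes no => (if σ.tuple i s = none then yes else no, σ)
  | ifCoordLe x y yes no =>
      (if ∃ a b, σ.coord cur P α β x = some a ∧ σ.coord cur P α β y = some b ∧ a ≤ b
        then yes else no, σ)
  | emit next => (next, { σ with output := σ.output ++ (node? n (σ.reg cur)).toList })
  | goto l => (goto l, σ)
  | halt => (halt, σ)

/-- The store in which a tree is left, and the loop that it jumps to (`none` if it halts). -/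
noncomputable def exec (cur : W) (P : Fin n → Fin k → ℝ) (α β : Fin k → ℝ) :
    Code k L W → Store k n W → Store k n W × Option L :=
  open Classical in fun c => match c with
  | const r c next => fun σ =>
      exec cur P α β next { σ with reg := Function.update σ.reg r c }
  | size r next => fun σ =>
      exec cur P α β next { σ with reg := Function.update σ.reg r n }
  | arith op r a b next => fun σ =>
      exec cur P α β next
        { σ with reg := Function.update σ.reg r (op.eval (σ.reg a) (σ.reg b)) }
  | ifLe a b yes no => fun σ =>
      if σ.reg a ≤ σ.reg b then exec cur P α β yes σ else exec cur P α β no σ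
  | store i s next => fun σ =>
      exec cur P α β next { σ with
        tuple := fun i' s' =>
          if i' = i ∧ s' = s then coord? P (σ.reg cur) i else σ.tuple i' s' }
  | clear i s next => fun σ =>
      exec cur P α β next
        { σ with tuple := fun i' s' => if i' = i ∧ s' = s then none else σ.tuple i' s' }
  | ifNull i s yes no => fun σ =>
      if σ.tuple i s = none then exec cur P α β yes σ else exec cur P α β no σ
  | ifCoordLe x y yes no => fun σ =>
      if ∃ a b, σ.coord cur P α β x = some a ∧ σ.coord cur P α β y = some b ∧ a ≤ b
        then exec cur P α β yes σ else exec cur P α β no σ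
  | emit next => fun σ =>
      exec cur P α β next { σ with output := σ.output ++ (node? n (σ.reg cur)).toList }
  | goto l => fun σ => (σ, some l)
  | halt => fun σ => (σ, none)

/-- The length of the longest path in a tree. -/
def height : Code k L W → ℕ
  | const _ _ next | size _ next | arith _ _ _ _ next | store _ _ next | clear _ _ next
  | emit next => next.height + 1
  | ifLe _ _ yes no | ifNull _ _ yes no | ifCoordLe _ _ yes no => max yes.height no.height + 1
  | goto _ | halt => 0

/-- The set of subtrees. -/
def parts : Code k L W → Set (Code k L W)
  | const r c next => insert (const r c next) next.parts
  | size r next => insert (size r next) next.parts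
  | arith op r a b next => insert (arith op r a b next) next.parts
  | ifLe a b yes no => insert (ifLe a b yes no) (yes.parts ∪ no.parts)
  | store i s next => insert (store i s next) next.parts
  | clear i s next => insert (clear i s next) next.parts
  | ifNull i s yes no => insert (ifNull i s yes no) (yes.parts ∪ no.parts)
  | ifCoordLe x y yes no => insert (ifCoordLe x y yes no) (yes.parts ∪ no.parts)
  | emit next => insert (emit next) next.parts
  | goto l => {goto l}
  | halt => {halt}

/-- The tree is a leaf. -/
def IsLeaf : Code k L W → Prop
  | goto _ | halt => True
  | _ => False

theorem finite_parts (c : Code k L W) : c.parts.Finite := by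
  induction c <;> simp_all [parts]

theorem mem_parts_self (c : Code k L W) : c ∈ c.parts := by
  cases c <;> simp [parts]

theorem parts_subset {c d : Code k L W} (h : c ∈ d.parts) : c.parts ⊆ d.parts := by
  induction d with
  | const _ _ _ ih | size _ _ ih | arith _ _ _ _ _ ih | store _ _ _ ih | clear _ _ _ ih
  | emit _ ih =>
    rcases h with rfl | h
    · rfl
    · exact (ih h).trans (Set.subset_insert _ _)
  | ifLe _ _ _ _ ih ih' | ifNull _ _ _ _ ih ih' | ifCoordLe _ _ _ _ ih ih' =>
    rcases h with rfl | h | h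
    · rfl
    · exact ((ih h).trans Set.subset_union_left).trans (Set.subset_insert _ _)
    · exact ((ih' h).trans Set.subset_union_right).trans (Set.subset_insert _ _)
  | goto _ | halt =>
    rcases h with rfl
    rfl

variable (cur : W) (P : Fin n → Fin k → ℝ) (α β : Fin k → ℝ)

theorem small_mem_parts (c : Code k L W) (σ : Store k n W) :
    (c.small cur P α β σ).1 ∈ c.parts := by
  cases c <;> simp only [small, parts] <;> (try split_ifs) <;> simp [mem_parts_self]

theorem exec_small (c : Code k L W) (σ : Store k n W) :
    (c.small cur P α β σ).1.exec cur P α β (c.small cur P α β σ).2 = c.exec cur P α β σ := by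
  cases c <;> simp only [small, exec] <;> (try split_ifs) <;> rfl

theorem height_small {c : Code k L W} (hc : ¬ c.IsLeaf) (σ : Store k n W) :
    (c.small cur P α β σ).1.height + 1 ≤ c.height := by
  cases c <;> simp only [small, height] <;> (try split_ifs) <;>
    first | omega | exact absurd trivial hc

theorem sizeOf_small {c : Code k L W} (hc : ¬ c.IsLeaf) (σ : Store k n W) :
    sizeOf (c.small cur P α β σ).1 < sizeOf c := by
  cases c <;> simp only [small] <;> (try split_ifs) <;>
    first | (simp; done) | (simp; omega) | exact absurd trivial hc

end Code

/-- A program made of loop bodies. -/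
structure LoopProgram (k : ℕ) where
  L : Type
  W : Type
  finite_loops : Finite L
  finite_registers : Finite W
  start : L
  head : L
  cur : W
  out : W
  body : L → Code k L W
  -- This makes every pass through a body cost at least one step, and it keeps halting labels apart
  -- from the labels at which loops start.
  body_not_leaf : ∀ l, ¬ (body l).IsLeaf

/-! ### Translation of loop programs into the machine model. -/

namespace LoopProgram

variable {k n : ℕ} (M : LoopProgram k)

/-- A label is a loop together with a subtree of its body. -/
abbrev Label : Type := {p : M.L × Code k M.L M.W // p.2 ∈ (M.body p.1).parts}

theorem finite_label : Finite M.Label := by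
  have := M.finite_loops
  have : {p : M.L × Code k M.L M.W | p.2 ∈ (M.body p.1).parts}.Finite := by
    refine (Set.finite_iUnion (f := fun l => (fun c => (l, c)) '' (M.body l).parts)
      fun l => (M.body l).finite_parts.image _).subset ?_
    rintro ⟨l, c⟩ h
    exact Set.mem_iUnion.2 ⟨l, c, h, rfl⟩
  exact this.to_subtype

/-- The label at which a loop starts. -/
def entry (l : M.L) : M.Label := ⟨(l, M.body l), Code.mem_parts_self _⟩

open Classical in
/-- The label of a subtree of the body of the loop `l`; a jump is resolved. -/
noncomputable def label (l : M.L) (c : Code k M.L M.W) : M.Label :=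
  match c with
  | .goto l' => M.entry l'
  -- The last alternative is a junk value: only subtrees of `M.body l` occur as successors of a
  -- label of the loop `l`.
  | c => if h : c ∈ (M.body l).parts then ⟨(l, c), h⟩ else M.entry l

/-- The program of the machine model. -/
noncomputable def toProgram : Program k where
  Λ := M.Label
  W := M.W
  finite_labels := M.finite_label
  finite_registers := M.finite_registers
  start := M.entry M.start
  head := M.entry M.head
  cur := M.cur
  out := M.out
  instr p := match p.1.2 with
    | .const r c next => .const r c (M.label p.1.1 next)
    | .size r next => .size r (M.label p.1.1 next)
    | .arith op r a b next => .arith op r a b (M.label p.1.1 next)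
    | .ifLe a b yes no => .ifLe a b (M.label p.1.1 yes) (M.label p.1.1 no)
    | .store i s next => .store i s (M.label p.1.1 next)
    | .clear i s next => .clear i s (M.label p.1.1 next)
    | .ifNull i s yes no => .ifNull i s (M.label p.1.1 yes) (M.label p.1.1 no)
    | .ifCoordLe x y yes no => .ifCoordLe x y (M.label p.1.1 yes) (M.label p.1.1 no)
    | .emit next => .emit (M.label p.1.1 next)
    -- Such a label is never reached, because `label` resolves jumps: a jump costs no step of its
    -- own.
    | .goto _ => .halt
    | .halt => .halt

/-- The configuration with a given label and store. -/
def conf (p : M.Label) (σ : Store k n M.W) : Config M.toProgram n :=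
  ⟨p, σ.reg, σ.tuple, σ.output⟩

variable (P : Fin n → Fin k → ℝ) (α β : Fin k → ℝ)

theorem coord_eq (p : M.Label) (σ : Store k n M.W) (x : CoordArg k) :
    x.eval P α β (M.conf p σ) = σ.coord M.cur P α β x := by
  cases x <;> rfl

theorem label_of_not_leaf {l : M.L} {c : Code k M.L M.W} (h : c ∈ (M.body l).parts)
    (hc : ¬ c.IsLeaf) : M.label l c = ⟨(l, c), h⟩ := by
  cases c <;> first | exact absurd trivial hc | exact dif_pos h

theorem label_halt {l : M.L} (h : Code.halt ∈ (M.body l).parts) :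
    M.label l Code.halt = ⟨(l, Code.halt), h⟩ :=
  dif_pos h

theorem label_body (l : M.L) : M.label l (M.body l) = M.entry l :=
  M.label_of_not_leaf (Code.mem_parts_self _) (M.body_not_leaf l)

theorem entry_injective : Function.Injective M.entry := by
  intro l l' h
  exact congrArg (fun p : M.Label => p.1.1) h

theorem step_conf {l : M.L} {c : Code k M.L M.W} (h : c ∈ (M.body l).parts)
    (hc : ¬ c.IsLeaf) (σ : Store k n M.W) :
    M.toProgram.step P α β (M.conf (M.label l c) σ) =
      M.conf (M.label l (c.small M.cur P α β σ).1) (c.small M.cur P α β σ).2 := by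
  rw [M.label_of_not_leaf h hc]
  cases c <;> first | exact absurd trivial hc | skip
  case ifLe a b yes no =>
    change M.conf (if σ.reg a ≤ σ.reg b then M.label l yes else M.label l no) σ = _
    rw [← apply_ite (M.label l)]
    rfl
  case ifNull i s yes no =>
    classical
    change M.conf (if σ.tuple i s = none then M.label l yes else M.label l no) σ = _
    rw [← apply_ite (M.label l)]
    rfl
  case ifCoordLe x y yes no =>
    simp only [Code.small, ← M.coord_eq P α β ⟨(l, .ifCoordLe x y yes no), h⟩ σ]
    rw [apply_ite (M.label l)]
    rfl
  all_goals rfl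

/-- The machine executes a tree: it follows a path in the tree and then is at the start of the loop
to which the tree jumps, or has halted. -/
theorem run_code (l : M.L) (c : Code k M.L M.W) (h : c ∈ (M.body l).parts)
    (σ : Store k n M.W) :
    ∃ d ≤ c.height, (¬ c.IsLeaf → 1 ≤ d) ∧ (c.IsLeaf → d = 0) ∧
      (∀ d', 0 < d' → d' < d → ∃ p σ', (M.toProgram.step P α β)^[d'] (M.conf (M.label l c) σ) =
        M.conf p σ' ∧ p.1.1 = l ∧ sizeOf p.1.2 < sizeOf c) ∧
      match (c.exec M.cur P α β σ).2 with
      | some l' => (M.toProgram.step P α β)^[d] (M.conf (M.label l c) σ) =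
          M.conf (M.entry l') (c.exec M.cur P α β σ).1
      | none => ∃ p : M.Label, p.1.2 = Code.halt ∧
          (M.toProgram.step P α β)^[d] (M.conf (M.label l c) σ) =
            M.conf p (c.exec M.cur P α β σ).1 := by
  induction hN : sizeOf c using Nat.strong_induction_on generalizing c σ with
  | _ N ih =>
    subst hN
    by_cases hc : c.IsLeaf
    · refine ⟨0, Nat.zero_le _, fun h => absurd hc h, fun _ => rfl, fun d' _ h2 => absurd h2 (Nat.not_lt_zero _),
        ?_⟩
      cases c <;> first | exact hc.elim | skip
      · rfl
      · exact ⟨⟨(l, .halt), h⟩, rfl, by rw [M.label_halt h]; rfl⟩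
    · obtain ⟨d, hd, -, hleaf0, hmid, hend⟩ := ih _ (Code.sizeOf_small M.cur P α β hc σ) _
        (Code.parts_subset h (Code.small_mem_parts M.cur P α β c σ))
        (c.small M.cur P α β σ).2 rfl
      rw [Code.exec_small] at hend
      refine ⟨d + 1, (Nat.succ_le_succ hd).trans (Code.height_small M.cur P α β hc σ),
        fun _ => Nat.succ_pos _, fun h => absurd h hc, ?_, ?_⟩
      · intro d' h1 h2
        obtain ⟨e, rfl⟩ : ∃ e, d' = e + 1 := ⟨d' - 1, by omega⟩
        rw [Function.iterate_succ_apply, M.step_conf P α β h hc]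
        rcases Nat.eq_zero_or_pos e with rfl | he
        · by_cases hleaf : (c.small M.cur P α β σ).1.IsLeaf
          · have := hleaf0 hleaf
            omega
          · exact ⟨_, _, rfl, by rw [M.label_of_not_leaf (Code.parts_subset h
              (Code.small_mem_parts M.cur P α β c σ)) hleaf],
              by rw [M.label_of_not_leaf (Code.parts_subset h
              (Code.small_mem_parts M.cur P α β c σ)) hleaf]
                 exact Code.sizeOf_small M.cur P α β hc σ⟩
        · obtain ⟨p, σ', h3, h4, h5⟩ := hmid e he (by omega)
          exact ⟨p, σ', h3, h4, h5.trans (Code.sizeOf_small M.cur P α β hc σ)⟩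
      · simpa only [Function.iterate_succ_apply, M.step_conf P α β h hc] using hend

/-- A proper subtree is smaller than the body it comes from, whereas an entry label carries a whole
body. Hence the head is never met in the middle of a round, and the tuple need only be correct
between rounds. -/
theorem label_ne_entry {p : M.Label} {l : M.L} (hl : p.1.1 = l)
    (hp : sizeOf p.1.2 < sizeOf (M.body l)) (l' : M.L) : p ≠ M.entry l' := by
  rintro rfl
  subst hl
  exact lt_irrefl _ hp

theorem halt_ne_entry {p : M.Label} (hp : p.1.2 = Code.halt) (l' : M.L) : p ≠ M.entry l' := by
  rintro rfl
  refine M.body_not_leaf l' ?_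
  change M.body l' = Code.halt at hp
  rw [hp]
  trivial

theorem halted_of_halt {p : M.Label} (hp : p.1.2 = Code.halt) (σ : Store k n M.W) :
    (M.conf p σ).Halted := by
  obtain ⟨⟨l, c⟩, h⟩ := p
  subst hp
  rfl

/-- The machine executes a loop body. -/
theorem run_body (l : M.L) (σ : Store k n M.W) :
    ∃ d, 1 ≤ d ∧ d ≤ (M.body l).height ∧
      (∀ d', 0 < d' → d' < d → ∀ l',
        ((M.toProgram.step P α β)^[d'] (M.conf (M.entry l) σ)).label ≠ M.entry l') ∧
      (∀ l', ((M.body l).exec M.cur P α β σ).2 = some l' →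
        (M.toProgram.step P α β)^[d] (M.conf (M.entry l) σ) =
          M.conf (M.entry l') ((M.body l).exec M.cur P α β σ).1) ∧
      (((M.body l).exec M.cur P α β σ).2 = none → ∃ p : M.Label, p.1.2 = Code.halt ∧
        (M.toProgram.step P α β)^[d] (M.conf (M.entry l) σ) =
          M.conf p ((M.body l).exec M.cur P α β σ).1) := by
  obtain ⟨d, hd, h1, -, hmid, hend⟩ := M.run_code P α β l (M.body l) (Code.mem_parts_self _) σ
  rw [label_body] at hmid hend
  refine ⟨d, h1 (M.body_not_leaf l), hd, ?_, ?_, ?_⟩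
  · intro d' h2 h3 l'
    obtain ⟨p, σ', h4, h5, h6⟩ := hmid d' h2 h3
    rw [h4]
    exact M.label_ne_entry h5 h6 l'
  · intro l' hl'
    rw [hl'] at hend
    exact hend
  · intro hl'
    rw [hl'] at hend
    exact hend

theorem step_of_halted {M : Program k} {P : Fin n → Fin k → ℝ} {α β : Fin k → ℝ}
    {σ : Config M n} (h : σ.Halted) : M.step P α β σ = σ := by
  simp only [Config.Halted] at h
  simp only [Program.step, h]

/-- If an invariant of the loop bodies holds initially, then the machine is always in the course of
executing a body from a store that satisfies it, and it is at the label of a loop only at the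
start of its body. -/
theorem run_invariant {H : ℕ} (hH : ∀ l, (M.body l).height ≤ H)
    (I : M.L → Store k n M.W → Prop) (hstart : I M.start ⟨fun _ => 0, fun _ _ => none, []⟩)
    (hstep : ∀ l σ, I l σ → ∀ l', ((M.body l).exec M.cur P α β σ).2 = some l' →
      I l' ((M.body l).exec M.cur P α β σ).1) (T : ℕ) :
    ∃ l σ, I l σ ∧ ∃ d ≤ H, M.toProgram.run P α β T =
        (M.toProgram.step P α β)^[d] (M.conf (M.entry l) σ) ∧
      (∀ l', (M.toProgram.run P α β T).label = M.entry l' → d = 0 ∧ l = l') := by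
  choose D hD1 hDH hmid hsome hnone using M.run_body P α β
  -- The induction needs to know where in the body the machine is: strictly before its end, or
  -- stopped at its end. The end of a body that jumps counts as position `0` of the next body.
  suffices h : ∃ l σ, I l σ ∧ ∃ d, M.toProgram.run P α β T =
        (M.toProgram.step P α β)^[d] (M.conf (M.entry l) σ) ∧
        (d < D l σ ∨ d = D l σ ∧ ∃ p σ', p.1.2 = .halt ∧ M.toProgram.run P α β T = M.conf p σ') by
    obtain ⟨l, σ, hI, d, hrun, hd⟩ := h
    refine ⟨l, σ, hI, d, ?_, hrun, ?_⟩
    · have := (hDH l σ).trans (hH l)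
      omega
    · intro l' hl'
      rcases hd with hd | ⟨-, p, σ', hp, hd⟩
      · rcases Nat.eq_zero_or_pos d with rfl | hpos
        · refine ⟨rfl, ?_⟩
          rw [hrun] at hl'
          exact M.entry_injective hl'
        · rw [hrun] at hl'
          exact absurd hl' (hmid l σ d hpos hd l')
      · rw [hd] at hl'
        exact absurd hl' (M.halt_ne_entry hp l')
  induction T with
  | zero => exact ⟨M.start, _, hstart, 0, rfl, Or.inl (hD1 _ _)⟩
  | succ T ih =>
    have hsucc : M.toProgram.run P α β (T + 1) =
        M.toProgram.step P α β (M.toProgram.run P α β T) := Function.iterate_succ_apply' _ _ _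
    obtain ⟨l, σ, hI, d, hrun, hd | ⟨hd, p, σ', hp, hd'⟩⟩ := ih
    · have hrun' : M.toProgram.run P α β (T + 1) =
          (M.toProgram.step P α β)^[d + 1] (M.conf (M.entry l) σ) := by
        rw [hsucc, hrun, Function.iterate_succ_apply']
      rcases Nat.lt_or_ge (d + 1) (D l σ) with hlt | hge
      · exact ⟨l, σ, hI, d + 1, hrun', Or.inl hlt⟩
      · have hDeq : d + 1 = D l σ := by omega
        cases hex : ((M.body l).exec M.cur P α β σ).2 with
        | some l' =>
          refine ⟨l', _, hstep l σ hI l' hex, 0, ?_, Or.inl (hD1 _ _)⟩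
          rw [hrun', hDeq, hsome l σ l' hex]
          rfl
        | none =>
          obtain ⟨p, hp, hp'⟩ := hnone l σ hex
          exact ⟨l, σ, hI, d + 1, hrun', Or.inr ⟨hDeq, p, _, hp, by rw [hrun', hDeq, hp']⟩⟩
    · have : M.toProgram.run P α β (T + 1) = M.toProgram.run P α β T := by
        rw [hsucc, step_of_halted]
        rw [hd']
        exact M.halted_of_halt hp σ'
      rw [this]
      exact ⟨l, σ, hI, d, hrun, Or.inr ⟨hd, p, σ', hp, hd'⟩⟩

/-- Iterating a step that is simulated by executions of loop bodies. -/
theorem run_iterate {H : ℕ} (hH : ∀ l, (M.body l).height ≤ H) (l : M.L) (N : ℕ)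
    (f : ℕ → Store k n M.W)
    (hf : ∀ m < N, (M.body l).exec M.cur P α β (f m) = (f (m + 1), some l)) :
    ∃ T ≤ H * N, (M.toProgram.step P α β)^[T] (M.conf (M.entry l) (f 0)) =
      M.conf (M.entry l) (f N) := by
  induction N with
  | zero => exact ⟨0, le_rfl, rfl⟩
  | succ N ih =>
    obtain ⟨T, hT, hrun⟩ := ih fun m hm => hf m (by omega)
    obtain ⟨d, -, hd, -, hsome, -⟩ := M.run_body P α β l (f N)
    refine ⟨d + T, by have := hH l; rw [Nat.mul_succ]; omega, ?_⟩
    have h := hf N (by omega)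
    rw [Function.iterate_add_apply, hrun, hsome l (by rw [h]), h]

end LoopProgram

/-! ### The size of words -/

theorem exists_const_bound {k : ℕ} (M : Program k) :
    ∃ K, ∀ l r c next, M.instr l = .const r c next → Nat.size c ≤ K := by
  have := M.finite_labels
  obtain ⟨K, hK⟩ := (Set.finite_range fun l : M.Λ =>
    match M.instr l with
    | .const _ c _ => Nat.size c
    | _ => 0).bddAbove
  refine ⟨K, fun l r c next h => ?_⟩
  have := hK ⟨l, rfl⟩
  simpa only [h] using this

theorem size_eval_le {s : ℕ} (hs : 1 ≤ s) (op : WordOp) {a b : ℕ} (ha : Nat.size a ≤ s)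
    (hb : Nat.size b ≤ s) : Nat.size (op.eval a b) ≤ 2 * s := by
  rw [Nat.size_le] at *
  have h2 : 2 ^ (2 * s) = 2 ^ s * 2 ^ s := by rw [two_mul, pow_add]
  -- Since `1 ≤ s`, doubling costs no more than squaring, so sums obey the bound for products.
  have h1 : 2 * 2 ^ s ≤ 2 ^ s * 2 ^ s :=
    Nat.mul_le_mul_right _ ((Nat.pow_le_pow_right (by norm_num) hs).trans' (by norm_num))
  cases op
  · simp only [WordOp.eval]
    omega
  · simp only [WordOp.eval]
    omega
  · simp only [WordOp.eval]
    rw [h2]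
    exact Nat.mul_lt_mul'' ha hb
  · simp only [WordOp.eval]
    have := Nat.div_le_self a b
    omega

/-- A step at most doubles the number of bits of the words. -/
theorem size_step_le {k n s : ℕ} {M : Program k} (P : Fin n → Fin k → ℝ) (α β : Fin k → ℝ)
    (hs : 1 ≤ s) (hn : Nat.size n ≤ s)
    (hc : ∀ l r c next, M.instr l = .const r c next → Nat.size c ≤ s) {σ : Config M n}
    (hσ : ∀ r, Nat.size (σ.reg r) ≤ s) (r : M.W) :
    Nat.size ((M.step P α β σ).reg r) ≤ 2 * s := by
  classical
  have key : ∀ (r' : M.W) (x : ℕ), Nat.size x ≤ 2 * s →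
      Nat.size (Function.update σ.reg r' x r) ≤ 2 * s := by
    intro r' x hx
    rw [Function.update_apply]
    split_ifs
    · exact hx
    · exact (hσ r).trans (by omega)
  cases h : M.instr σ.label with
  | const r' c next =>
    simp only [Program.step, h]
    convert key r' c ((hc _ _ _ _ h).trans (by omega))
  | size r' next =>
    simp only [Program.step, h]
    convert key r' n (hn.trans (by omega))
  | arith op r' a b next =>
    simp only [Program.step, h]
    convert key r' _ (size_eval_le hs op (hσ a) (hσ b))
  | _ =>
    simp only [Program.step, h]
    exact (hσ r).trans (by omega)

/-- The exponential factor is harmless: the lemma is used only within one loop body, where `d` is at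
most the height of the body. -/
theorem size_iterate_le {k n s : ℕ} {M : Program k} (P : Fin n → Fin k → ℝ) (α β : Fin k → ℝ)
    (hs : 1 ≤ s) (hn : Nat.size n ≤ s)
    (hc : ∀ l r c next, M.instr l = .const r c next → Nat.size c ≤ s) {σ : Config M n}
    (hσ : ∀ r, Nat.size (σ.reg r) ≤ s) (d : ℕ) (r : M.W) :
    Nat.size (((M.step P α β)^[d] σ).reg r) ≤ 2 ^ d * s := by
  induction d generalizing r with
  | zero => simpa using hσ r
  | succ d ih =>
    have h1 : s ≤ 2 ^ d * s := Nat.le_mul_of_pos_left _ (by positivity)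
    rw [Function.iterate_succ_apply', pow_succ', mul_assoc]
    exact size_step_le P α β (hs.trans h1) (hn.trans h1)
      (fun l r c next h => (hc l r c next h).trans h1) ih r

/-! ### Sides and children -/

namespace Side

/-- The opposite side. -/
def opp : Side → Side
  | lower => upper
  | upper => lower

/-- The right child is the one that is cut from below. -/
def bit : Side → ℕ
  | lower => 1
  | upper => 0

/-- The point `x` is on the inner side of a facet at `c` on side `s`. -/
def le : Side → ℝ → ℝ → Prop
  | lower, c, x => c ≤ x
  | upper, c, x => x ≤ c

theorem le_trans {s : Side} {a b c : ℝ} (h : s.le a b) (h' : s.le b c) : s.le a c := by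
  cases s
  · exact _root_.le_trans h h'
  · exact _root_.le_trans h' h

theorem opp_le {s : Side} {a b : ℝ} : s.opp.le a b ↔ s.le b a := by
  cases s <;> rfl

theorem opp_opp (s : Side) : s.opp.opp = s := by
  cases s <;> rfl

theorem eq_or_eq_opp (s s' : Side) : s' = s ∨ s' = s.opp := by
  cases s <;> cases s' <;> simp [opp]

theorem opp_ne (s : Side) : s.opp ≠ s := by
  cases s <;> simp [opp]

theorem bit_le (s : Side) : s.bit ≤ 1 := by
  cases s <;> simp [bit]

instance : Finite Side :=
  Finite.of_surjective (fun b : Bool => if b then lower else upper) fun s => by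
    cases s
    · exact ⟨true, rfl⟩
    · exact ⟨false, rfl⟩

end Side

/-- The child of `t` that is cut at side `s`. -/
def child (t : ℕ) (s : Side) : ℕ := 2 * t + s.bit

theorem child_div (t : ℕ) (s : Side) : child t s / 2 = t := by
  have := s.bit_le
  simp only [child]
  omega

theorem lt_child {t : ℕ} (ht : 1 ≤ t) (s : Side) : t < child t s := by
  simp only [child]
  omega

theorem exists_eq_child {t : ℕ} (ht : 2 ≤ t) : ∃ p s, 1 ≤ p ∧ t = child p s := by
  rcases Nat.mod_two_eq_zero_or_one t with h | h
  · exact ⟨t / 2, .upper, by omega, by simp only [child, Side.bit]; omega⟩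
  · exact ⟨t / 2, .lower, by omega, by simp only [child, Side.bit]; omega⟩

theorem log_child {t : ℕ} (ht : 1 ≤ t) (s : Side) :
    Nat.log 2 (child t s) = Nat.log 2 t + 1 := by
  rw [Nat.log_of_one_lt_of_le (by norm_num) (by simp only [child]; omega), child_div]

theorem div_two_pow_succ (t m : ℕ) : t / 2 ^ (m + 1) = t / 2 / 2 ^ m := by
  rw [pow_succ', Nat.div_div_eq_div_mul]

/-- The splitting coordinate at node `t`. -/
def dir (k : ℕ) [NeZero k] (t : ℕ) : Fin k :=
  ⟨Nat.log 2 t % k, Nat.mod_lt _ (Nat.pos_of_ne_zero (NeZero.ne k))⟩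

/-! ### Cells, the query range, and the node at which a facet starts to meet it. -/

section

variable {k n : ℕ}

/-- Coordinate `i` of the point at node `t`. -/
noncomputable def pt (P : Fin n → Fin k → ℝ) (t : ℕ) (i : Fin k) : ℝ :=
  -- The default matters only outside `1 ≤ t ≤ n`.
  (coord? P t i).getD 0

/-- The endpoint of the query range on side `s` in direction `i`. -/
def endpoint (α β : Fin k → ℝ) (s : Side) (i : Fin k) : ℝ :=
  match s with
  | .lower => α i
  | .upper => β i

/-- The point at node `t` lies in the query range. -/
def InRange (P : Fin n → Fin k → ℝ) (α β : Fin k → ℝ) (t : ℕ) : Prop :=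
  ∀ i, α i ≤ pt P t i ∧ pt P t i ≤ β i

/-- The cell of `t` intersects the query range. -/
def Good (P : Fin n → Fin k → ℝ) (α β : Fin k → ℝ) (t : ℕ) : Prop :=
  -- Two nonempty boxes meet iff in each coordinate neither lies beyond the other. In a `k`-d tree
  -- the cell of a node of the array is nonempty, since it contains the point of the node.
  ∀ i s c, cellBound P t i s = some c → s.le c (endpoint α β s.opp i)

/-- The boundary value of the cell of `t` exists and lies in the query interval. -/
def InBand (P : Fin n → Fin k → ℝ) (α β : Fin k → ℝ) (t : ℕ) (i : Fin k) (s : Side) : Prop :=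
  ∃ c, cellBound P t i s = some c ∧ s.le (endpoint α β s i) c ∧ s.le c (endpoint α β s.opp i)

theorem endpoint_mem {α β : Fin k → ℝ} {i : Fin k} {c : ℝ} (s : Side) :
    (s.le (endpoint α β s i) c ∧ s.le c (endpoint α β s.opp i)) ↔ α i ≤ c ∧ c ≤ β i := by
  cases s
  · rfl
  · exact and_comm

open Classical in
/-- The number of the node at which the topmost facet that meets the query range appears on the path
from the root to `t`, and `0` if there is none. -/
noncomputable def origin (P : Fin n → Fin k → ℝ) (α β : Fin k → ℝ) (t : ℕ) (i : Fin k)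
    (s : Side) : ℕ :=
  if _h : t ≤ 1 then 0
  else if origin P α β (t / 2) i s ≠ 0 then origin P α β (t / 2) i s
  else if InBand P α β t i s then t
  else 0
termination_by t
decreasing_by all_goals omega

/-- The tuple entry at node `t`. -/
noncomputable def entryAt (P : Fin n → Fin k → ℝ) (α β : Fin k → ℝ) (t : ℕ) (i : Fin k)
    (s : Side) : Option ℝ :=
  if origin P α β t i s = 0 then none else cellBound P (origin P α β t i s) i s

theorem coord?_eq (P : Fin n → Fin k → ℝ) {t : ℕ} (h1 : 1 ≤ t) (h2 : t ≤ n) (i : Fin k) :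
    coord? P t i = some (pt P t i) := by
  simp [pt, coord?, node?, h1, h2]

theorem pt_eq (P : Fin n → Fin k → ℝ) (j : Fin n) (i : Fin k) :
    pt P (j + 1) i = P j i := by
  have : (j : ℕ) + 1 ≤ n := j.2
  simp [pt, coord?, node?, this]

theorem cellBound_of_le_one (P : Fin n → Fin k → ℝ) {t : ℕ} (ht : t ≤ 1) (i : Fin k) (s : Side) :
    cellBound P t i s = none := by
  rw [cellBound, dif_pos ht]

variable {P : Fin n → Fin k → ℝ} {α β : Fin k → ℝ}

theorem good_root {t : ℕ} (ht : t ≤ 1) : Good P α β t := by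
  intro i s c hc
  rw [cellBound_of_le_one P ht] at hc
  cases hc

theorem not_inBand_of_le_one {t : ℕ} (ht : t ≤ 1) (i : Fin k) (s : Side) :
    ¬ InBand P α β t i s := by
  rintro ⟨c, hc, -⟩
  rw [cellBound_of_le_one P ht] at hc
  cases hc

theorem origin_of_le_one {t : ℕ} (ht : t ≤ 1) (i : Fin k) (s : Side) :
    origin P α β t i s = 0 := by
  rw [origin, dif_pos ht]

open Classical in
theorem origin_child {t : ℕ} (ht : 1 ≤ t) (s : Side) (i : Fin k) (s' : Side) :
    origin P α β (child t s) i s' = if origin P α β t i s' ≠ 0 then origin P α β t i s'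
      else if InBand P α β (child t s) i s' then child t s else 0 := by
  have h : ¬ child t s ≤ 1 := by simp only [child]; omega
  rw [origin, dif_neg h, child_div]

theorem origin_le (t : ℕ) (i : Fin k) (s : Side) : origin P α β t i s ≤ t := by
  induction t using Nat.strong_induction_on with
  | _ t ih =>
    rcases Nat.lt_or_ge t 2 with h2 | h2
    · rw [origin_of_le_one (by omega)]
      omega
    · obtain ⟨p, s', hp, rfl⟩ := exists_eq_child h2
      rw [origin_child hp]
      have := ih p (lt_child hp s')
      have := lt_child hp s'
      split_ifs <;> omega

variable [NeZero k]

open Classical in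
theorem cellBound_child (P : Fin n → Fin k → ℝ) {t : ℕ} (ht : 1 ≤ t) (s : Side) (i : Fin k)
    (s' : Side) : cellBound P (child t s) i s' =
      if i = dir k t ∧ s' = s then coord? P t i else cellBound P t i s' := by
  have h : ¬ child t s ≤ 1 := by simp only [child]; omega
  rw [cellBound, dif_neg h, child_div]
  refine if_congr (and_congr ?_ ?_) rfl rfl
  · exact (Fin.ext_iff (b := dir k t)).symm
  · cases s <;> cases s' <;> simp [child, Side.bit]

theorem cellBound_child_self (P : Fin n → Fin k → ℝ) {t : ℕ} (h1 : 1 ≤ t) (h2 : t ≤ n)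
    (s : Side) : cellBound P (child t s) (dir k t) s = some (pt P t (dir k t)) := by
  rw [cellBound_child P h1, if_pos ⟨rfl, rfl⟩, coord?_eq P h1 h2]

theorem cellBound_child_of_ne (P : Fin n → Fin k → ℝ) {t : ℕ} (ht : 1 ≤ t) {s : Side} {i : Fin k}
    {s' : Side} (h : ¬ (i = dir k t ∧ s' = s)) :
    cellBound P (child t s) i s' = cellBound P t i s' := by
  rw [cellBound_child P ht, if_neg h]

/-- The points in the subtree of a child are on the right side of the splitting hyperplane. -/
theorem IsKDTree.le_pt (hP : IsKDTree P) {u v m : ℕ} (hu : 1 ≤ u) (hv1 : 1 ≤ v) (hvn : v ≤ n)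
    {s : Side} (h : v / 2 ^ m = child u s) : s.le (pt P u (dir k u)) (pt P v (dir k u)) := by
  have hun : u ≤ n := by
    have h1 := Nat.div_le_self v (2 ^ m)
    have h2 := lt_child hu s
    omega
  obtain ⟨u, rfl⟩ : ∃ u', u = u' + 1 := ⟨u - 1, by omega⟩
  obtain ⟨v, rfl⟩ : ∃ v', v = v' + 1 := ⟨v - 1, by omega⟩
  have key := hP ⟨u, hun⟩ ⟨v, hvn⟩ (dir k (u + 1)) m rfl
  have e1 := pt_eq P ⟨u, hun⟩ (dir k (u + 1))
  have e2 := pt_eq P ⟨v, hvn⟩ (dir k (u + 1))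
  simp only at e1 e2 key
  rw [e1, e2]
  cases s
  · exact key.2 h
  · exact key.1 h

/-- The points of a subtree lie in the cell of its root. -/
theorem IsKDTree.bound_le (hP : IsKDTree P) {t v m : ℕ} (ht : 1 ≤ t) (hv1 : 1 ≤ v) (hvn : v ≤ n)
    (h : v / 2 ^ m = t) {i : Fin k} {s : Side} {c : ℝ} (hc : cellBound P t i s = some c) :
    s.le c (pt P v i) := by
  induction t using Nat.strong_induction_on generalizing m with
  | _ t ih =>
    rcases Nat.lt_or_ge t 2 with h2 | h2
    · rw [cellBound_of_le_one P (by omega)] at hc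
      cases hc
    · obtain ⟨p, s', hp, rfl⟩ := exists_eq_child h2
      by_cases hi : i = dir k p ∧ s = s'
      · obtain ⟨rfl, rfl⟩ := hi
        have hpn : p ≤ n := by
          have h3 := Nat.div_le_self v (2 ^ m)
          have h4 := lt_child hp s
          omega
        rw [cellBound_child_self P hp hpn] at hc
        cases hc
        exact hP.le_pt hp hv1 hvn h
      · rw [cellBound_child_of_ne P hp hi] at hc
        refine ih p (lt_child hp s') hp (?_ : v / 2 ^ (m + 1) = p) hc
        rw [pow_succ, ← Nat.div_div_eq_div_mul, h, child_div]

theorem IsKDTree.bound_le_self (hP : IsKDTree P) {t : ℕ} (ht : 1 ≤ t) (htn : t ≤ n) {i : Fin k}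
    {s : Side} {c : ℝ} (hc : cellBound P t i s = some c) : s.le c (pt P t i) :=
  hP.bound_le (m := 0) ht ht htn (by simp) hc

/-- Cells shrink on the way down: a bound that is replaced by the split value of `t` was weaker,
because the point at `t` lies in the cell of `t`. -/
theorem Good.of_child (hP : IsKDTree P) {t : ℕ} (ht : 1 ≤ t) (htn : t ≤ n) {s : Side}
    (h : Good P α β (child t s)) : Good P α β t := by
  intro i s' c hc
  by_cases hi : i = dir k t ∧ s' = s
  · obtain ⟨rfl, rfl⟩ := hi
    exact Side.le_trans (hP.bound_le_self ht htn hc) (h _ _ _ (cellBound_child_self P ht htn _))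
  · exact h i s' c (by rw [cellBound_child_of_ne P ht hi, hc])

theorem good_child {t : ℕ} (ht : 1 ≤ t) (htn : t ≤ n) (s : Side) (h : Good P α β t)
    (hs : s.le (pt P t (dir k t)) (endpoint α β s.opp (dir k t))) : Good P α β (child t s) := by
  intro i s' c hc
  by_cases hi : i = dir k t ∧ s' = s
  · obtain ⟨rfl, rfl⟩ := hi
    rw [cellBound_child_self P ht htn] at hc
    cases hc
    exact hs
  · rw [cellBound_child_of_ne P ht hi] at hc
    exact h i s' c hc

/-- If a child is not entered, then no point of its subtree lies in the query range. -/
theorem IsKDTree.not_inRange (hP : IsKDTree P) {t v m : ℕ} (ht : 1 ≤ t) {s : Side} (hv1 : 1 ≤ v)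
    (hvn : v ≤ n) (h : v / 2 ^ m = child t s)
    (hs : ¬ s.le (pt P t (dir k t)) (endpoint α β s.opp (dir k t))) : ¬ InRange P α β v := by
  intro hv
  refine hs (Side.le_trans (hP.le_pt ht hv1 hvn h) ?_)
  exact ((endpoint_mem s).2 (hv (dir k t))).2

/-- The key monotonicity. If this very facet is cut again, its value moves inwards from a value in
the query interval, and it cannot leave the interval at the far end because the child still meets
the query range. So one stored value serves all nodes below on the walk. -/
theorem InBand.child (hP : IsKDTree P) {t : ℕ} (ht : 1 ≤ t) (htn : t ≤ n) {s : Side}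
    (h : Good P α β (child t s)) {i : Fin k} {s' : Side} (hb : InBand P α β t i s') :
    InBand P α β (child t s) i s' := by
  obtain ⟨c, hc, h1, h2⟩ := hb
  by_cases hi : i = dir k t ∧ s' = s
  · obtain ⟨rfl, rfl⟩ := hi
    refine ⟨_, cellBound_child_self P ht htn _, Side.le_trans h1 (hP.bound_le_self ht htn hc), ?_⟩
    exact h _ _ _ (cellBound_child_self P ht htn _)
  · exact ⟨c, by rw [cellBound_child_of_ne P ht hi, hc], h1, h2⟩

/-- If all facets meet the query range, then all points of the subtree lie in it. -/
theorem IsKDTree.inRange_of_inBand (hP : IsKDTree P) {t v m : ℕ} (ht : 1 ≤ t) (hv1 : 1 ≤ v)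
    (hvn : v ≤ n) (h : v / 2 ^ m = t) (hb : ∀ i s, InBand P α β t i s) : InRange P α β v := by
  intro i
  obtain ⟨c, hc, h1, -⟩ := hb i .lower
  obtain ⟨c', hc', h1', -⟩ := hb i .upper
  exact ⟨le_trans h1 (hP.bound_le ht hv1 hvn h hc), le_trans (hP.bound_le ht hv1 hvn h hc') h1'⟩

/-! ### The tuple of boundary split values -/

/-- By `InBand.child` the nodes on the path to `t` with the facet in the query interval form a final
segment, and `origin` is its topmost node. This turns the recursion of `origin` into the extremal
description in `IsBoundaryEntry`. -/
theorem origin_spec (hP : IsKDTree P) {t : ℕ} (htn : t ≤ n) (h : Good P α β t) (i : Fin k)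
    (s : Side) :
    (origin P α β t i s = 0 → ∀ m, ¬ InBand P α β (t / 2 ^ m) i s) ∧
    (origin P α β t i s ≠ 0 → InBand P α β t i s ∧ ∃ m, t / 2 ^ m = origin P α β t i s ∧
      InBand P α β (t / 2 ^ m) i s ∧ ∀ m' > m, ¬ InBand P α β (t / 2 ^ m') i s) := by
  induction t using Nat.strong_induction_on with
  | _ t ih =>
    rcases Nat.lt_or_ge t 2 with h2 | h2
    · rw [origin_of_le_one (by omega)]
      refine ⟨fun _ m => not_inBand_of_le_one ?_ i s, fun h => absurd rfl h⟩
      exact (Nat.div_le_self _ _).trans (by omega)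
    · obtain ⟨p, s', hp, rfl⟩ := exists_eq_child h2
      have hlt := lt_child hp s'
      obtain ⟨ih1, ih2⟩ := ih p hlt (by omega) (h.of_child hP hp (by omega))
      have hdiv : ∀ m, child p s' / 2 ^ (m + 1) = p / 2 ^ m := fun m => by
        rw [div_two_pow_succ, child_div]
      have hanc : ∀ m, (∀ m' > m, ¬ InBand P α β (p / 2 ^ m') i s) →
          ∀ m' > m + 1, ¬ InBand P α β (child p s' / 2 ^ m') i s := by
        intro m hm m' hm'
        obtain ⟨e, rfl⟩ : ∃ e, m' = e + 1 := ⟨m' - 1, by omega⟩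
        rw [hdiv]
        exact hm e (by omega)
      rw [origin_child hp]
      by_cases ho : origin P α β p i s = 0
      · have hno := ih1 ho
        rw [if_neg (not_not.2 ho)]
        split_ifs with hb
        · refine ⟨fun h0 => by omega, fun _ => ⟨hb, 0, by simp, by simpa using hb, ?_⟩⟩
          intro m' hm'
          obtain ⟨e, rfl⟩ : ∃ e, m' = e + 1 := ⟨m' - 1, by omega⟩
          rw [hdiv]
          exact hno e
        · refine ⟨fun _ m => ?_, fun h => absurd rfl h⟩
          cases m with
          | zero => simpa using hb
          | succ m => rw [hdiv]; exact hno m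
      · rw [if_pos ho]
        obtain ⟨hb, m, hm1, hm2, hm3⟩ := ih2 ho
        exact ⟨fun h0 => absurd h0 ho, fun _ => ⟨hb.child hP hp (by omega) h, m + 1,
          by rw [hdiv, hm1], by rw [hdiv]; exact hm2, hanc m hm3⟩⟩

theorem origin_ne_zero_iff (hP : IsKDTree P) {t : ℕ} (htn : t ≤ n) (h : Good P α β t) (i : Fin k)
    (s : Side) : origin P α β t i s ≠ 0 ↔ InBand P α β t i s := by
  obtain ⟨h1, h2⟩ := origin_spec hP htn h i s
  refine ⟨fun h0 => (h2 h0).1, fun hb h0 => h1 h0 0 (by simpa using hb)⟩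

theorem entryAt_eq_none_iff (hP : IsKDTree P) {t : ℕ} (htn : t ≤ n) (h : Good P α β t) (i : Fin k)
    (s : Side) : entryAt P α β t i s = none ↔ origin P α β t i s = 0 := by
  rw [entryAt]
  split_ifs with h0
  · simp [h0]
  · obtain ⟨-, m, hm, ⟨c, hc, -⟩, -⟩ := (origin_spec hP htn h i s).2 h0
    rw [hm] at hc
    simp [hc, h0]

/-- For a node whose cell meets the query range, a facet meets it as soon as its boundary value lies
in the query interval. -/
theorem faceMeets_iff (hP : IsKDTree P) (hQ : ∀ i, α i ≤ β i) {t : ℕ} (ht : 1 ≤ t) (htn : t ≤ n)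
    (h : Good P α β t) (i : Fin k) (s : Side) :
    FaceMeets P (Set.Icc α β) t i s ↔ InBand P α β t i s := by
  constructor
  · rintro ⟨c, hc, x, -, rfl, hx⟩
    exact ⟨_, hc, (endpoint_mem s).2 ⟨hx.1 i, hx.2 i⟩⟩
  · rintro ⟨c, hc, hq⟩
    rw [endpoint_mem] at hq
    classical
    -- The witness is the point at `t` clamped to the query box, with coordinate `i` moved to the
    -- facet. Clamping stays in the cell because the point is in the cell and the cell meets the
    -- query range.
    refine ⟨c, hc, fun j => if j = i then c else max (α j) (min (β j) (pt P t j)), ?_, if_pos rfl,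
      fun j => ?_, fun j => ?_⟩
    · intro j
      by_cases hj : j = i
      · subst hj
        simp only [if_true]
        have hp := hP.bound_le_self ht htn hc
        constructor <;> intro b hb <;> have hb' := hP.bound_le_self ht htn hb
        · cases s
          · rw [hc] at hb
            cases hb
            exact le_rfl
          · exact le_trans hb' hp
        · cases s
          · exact le_trans hp hb'
          · rw [hc] at hb
            cases hb
            exact le_rfl
      · simp only [if_neg hj]
        constructor <;> intro b hb <;> have hb' := hP.bound_le_self ht htn hb <;>
          have hg := h _ _ _ hb
        · exact le_max_of_le_right (le_min hg hb')
        · exact max_le hg ((min_le_right _ _).trans hb')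
    · dsimp only
      split_ifs with hj
      · subst hj
        exact hq.1
      · exact le_max_left _ _
    · dsimp only
      split_ifs with hj
      · subst hj
        exact hq.2
      · exact max_le (hQ j) (min_le_left _ _)

theorem Good.ancestor (hP : IsKDTree P) {t : ℕ} (htn : t ≤ n) (h : Good P α β t) (m : ℕ) :
    Good P α β (t / 2 ^ m) := by
  induction m with
  | zero => simpa using h
  | succ m ih =>
    rw [pow_succ, ← Nat.div_div_eq_div_mul]
    have hle := Nat.div_le_self t (2 ^ m)
    rcases Nat.lt_or_ge (t / 2 ^ m) 2 with h2 | h2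
    · exact good_root (by omega)
    · obtain ⟨p, s, hp, he⟩ := exists_eq_child h2
      have := lt_child hp s
      rw [he] at ih ⊢
      rw [child_div]
      exact ih.of_child hP hp (by omega)

theorem faceMeets_iff_ancestor (hP : IsKDTree P) (hQ : ∀ i, α i ≤ β i) {t : ℕ} (htn : t ≤ n)
    (h : Good P α β t) (i : Fin k) (s : Side) (m : ℕ) :
    FaceMeets P (Set.Icc α β) (t / 2 ^ m) i s ↔ InBand P α β (t / 2 ^ m) i s := by
  -- For large `m` the quotient is `0`, which is not a node; both sides are false there, since no
  -- bound exists.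
  rcases Nat.eq_zero_or_pos (t / 2 ^ m) with h0 | h0
  · rw [h0]
    refine iff_of_false ?_ (not_inBand_of_le_one (Nat.zero_le 1) i s)
    rintro ⟨c, hc, -⟩
    rw [cellBound_of_le_one P (Nat.zero_le 1)] at hc
    cases hc
  · exact faceMeets_iff hP hQ h0 ((Nat.div_le_self _ _).trans htn) (h.ancestor hP htn m) i s

theorem isBoundaryEntry_entryAt (hP : IsKDTree P) (hQ : ∀ i, α i ≤ β i) {t : ℕ} (ht : 1 ≤ t)
    (htn : t ≤ n) (h : Good P α β t) (i : Fin k) (s : Side) :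
    IsBoundaryEntry P (Set.Icc α β) t i s (entryAt P α β t i s) := by
  refine ⟨?_, fun c hc => ?_⟩
  · rw [Ne, entryAt_eq_none_iff hP htn h, ← Ne, origin_ne_zero_iff hP htn h,
      faceMeets_iff hP hQ ht htn h]
  · have h0 : origin P α β t i s ≠ 0 := by
      rw [Ne, ← entryAt_eq_none_iff hP htn h, hc]
      simp
    obtain ⟨-, m, hm1, hm2, hm3⟩ := (origin_spec hP htn h i s).2 h0
    rw [entryAt, if_neg h0, ← hm1] at hc
    simp only [faceMeets_iff_ancestor hP hQ htn h]
    exact ⟨m, hc, hm2, hm3⟩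

end

/-! ### Subtrees -/

open Classical in
/-- The node numbers of the subtree of `t`. -/
noncomputable def subtree (n t : ℕ) : Finset ℕ :=
  {v ∈ Finset.Icc 1 n | ∃ m : ℕ, v / 2 ^ m = t}

theorem mem_subtree {n t v : ℕ} : v ∈ subtree n t ↔ (1 ≤ v ∧ v ≤ n) ∧ ∃ m, v / 2 ^ m = t := by
  simp only [subtree, Finset.mem_filter, Finset.mem_Icc]

theorem subtree_eq_empty {n t : ℕ} (h : n < t) : subtree n t = ∅ := by
  refine Finset.eq_empty_of_forall_notMem fun v hv => ?_
  obtain ⟨⟨-, h2⟩, m, h3⟩ := mem_subtree.1 hv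
  have := Nat.div_le_self v (2 ^ m)
  omega

theorem subtree_root (n : ℕ) : subtree n 1 = Finset.Icc 1 n := by
  ext v
  rw [mem_subtree, Finset.mem_Icc, and_iff_left_iff_imp]
  rintro ⟨h1, -⟩
  refine ⟨Nat.log 2 v, ?_⟩
  have h2 := Nat.pow_log_le_self 2 (x := v) (by omega)
  have h3 := Nat.lt_pow_succ_log_self (b := 2) (by norm_num) v
  rw [pow_succ] at h3
  exact Nat.div_eq_of_lt_le (by omega) (by omega)

theorem subtree_eq {n t : ℕ} (h1 : 1 ≤ t) (h2 : t ≤ n) :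
    subtree n t = insert t (subtree n (child t .upper) ∪ subtree n (child t .lower)) := by
  ext v
  simp only [Finset.mem_insert, Finset.mem_union, mem_subtree]
  constructor
  · rintro ⟨hv, m, hm⟩
    cases m with
    | zero => exact Or.inl (by simpa using hm)
    | succ m =>
      rw [pow_succ, ← Nat.div_div_eq_div_mul] at hm
      refine Or.inr ?_
      rcases Nat.mod_two_eq_zero_or_one (v / 2 ^ m) with h | h
      · exact Or.inl ⟨hv, m, by simp only [child, Side.bit]; omega⟩
      · exact Or.inr ⟨hv, m, by simp only [child, Side.bit]; omega⟩
  · rintro (rfl | ⟨hv, m, hm⟩ | ⟨hv, m, hm⟩)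
    · exact ⟨⟨h1, h2⟩, 0, by simp⟩
    · exact ⟨hv, m + 1, by rw [pow_succ, ← Nat.div_div_eq_div_mul, hm, child_div]⟩
    · exact ⟨hv, m + 1, by rw [pow_succ, ← Nat.div_div_eq_div_mul, hm, child_div]⟩

theorem sum_subtree {n t : ℕ} (h1 : 1 ≤ t) (h2 : t ≤ n) (f : ℕ → ℕ) :
    ∑ v ∈ subtree n t, f v = f t + ∑ v ∈ subtree n (child t .upper), f v +
      ∑ v ∈ subtree n (child t .lower), f v := by
  have hnot : ∀ s, t ∉ subtree n (child t s) := by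
    intro s h
    obtain ⟨-, m, hm⟩ := mem_subtree.1 h
    have := Nat.div_le_self t (2 ^ m)
    have := lt_child h1 s
    omega
  have hdisj : Disjoint (subtree n (child t .upper)) (subtree n (child t .lower)) := by
    rw [Finset.disjoint_left]
    intro v hv hv'
    obtain ⟨-, m, hm⟩ := mem_subtree.1 hv
    obtain ⟨-, m', hm'⟩ := mem_subtree.1 hv'
    -- Both children are on the same level, so a common descendant would reach them after the same
    -- number of halvings, and they would coincide.
    have e := log_child h1 .upper
    have e' := log_child h1 .lower
    rw [← hm, Nat.log_div_base_pow] at e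
    rw [← hm', Nat.log_div_base_pow] at e'
    obtain rfl : m = m' := by omega
    rw [hm] at hm'
    simp only [child, Side.bit] at hm'
    omega
  rw [subtree_eq h1 h2, Finset.sum_insert, Finset.sum_union hdisj, add_assoc]
  simp [hnot]

/-- The number of nodes in the subtree of `t`, computed from the width of the subtree at the last
level. -/
def subtreeSize (n t : ℕ) : ℕ :=
  min (n + 1 - t * 2 ^ (Nat.log 2 n - Nat.log 2 t)) (2 ^ (Nat.log 2 n - Nat.log 2 t)) +
    2 ^ (Nat.log 2 n - Nat.log 2 t) - 1

/-- With `e` levels below `t`, the last one offers the numbers from `t * 2 ^ e` to `(t + 1) * 2 ^ e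
- 1`, of which those up to `n` are present; the levels above it are full and have `2 ^ e - 1` nodes.
The case `e = 0` admits `t > n`, so that the induction also covers a missing child on the last
level. -/
theorem card_subtree_aux {n : ℕ} (e : ℕ) {t : ℕ} (ht : 1 ≤ t)
    (he : Nat.log 2 t + e = Nat.log 2 n) :
    (∑ _v ∈ subtree n t, 1) + 1 = min (n + 1 - t * 2 ^ e) (2 ^ e) + 2 ^ e := by
  induction e generalizing t with
  | zero =>
    rcases Nat.lt_or_ge n t with h | h
    · rw [subtree_eq_empty h]
      simp
      omega
    · have hc : ∀ s, n < child t s := fun s => by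
        by_contra hcon
        have := Nat.log_mono_right (b := 2) (Nat.le_of_not_lt hcon)
        rw [log_child ht] at this
        omega
      rw [sum_subtree ht h, subtree_eq_empty (hc _), subtree_eq_empty (hc _)]
      simp
      omega
  | succ e ih =>
    have htn : t ≤ n := by
      by_contra hcon
      have := Nat.log_mono_right (b := 2) (Nat.le_of_lt (Nat.lt_of_not_le hcon))
      omega
    have h0 := ih (t := child t .upper) (by simp only [child]; omega) (by rw [log_child ht]; omega)
    have h1 := ih (t := child t .lower) (by simp only [child]; omega) (by rw [log_child ht]; omega)
    rw [sum_subtree ht htn]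
    have e0 : child t .upper * 2 ^ e = t * 2 ^ (e + 1) := by
      simp only [child, Side.bit]
      ring
    have e1 : child t .lower * 2 ^ e = t * 2 ^ (e + 1) + 2 ^ e := by
      simp only [child, Side.bit]
      ring
    rw [e0] at h0
    rw [e1] at h1
    have e2 : 2 ^ (e + 1) = 2 * 2 ^ e := pow_succ' 2 e
    have := Nat.one_le_two_pow (n := e)
    generalize t * 2 ^ (e + 1) = x at *
    omega

theorem sum_subtree_one {n t : ℕ} (h1 : 1 ≤ t) (h2 : t ≤ n) :
    ∑ _v ∈ subtree n t, 1 = subtreeSize n t := by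
  have := card_subtree_aux (n := n) (Nat.log 2 n - Nat.log 2 t) h1
    (by have := Nat.log_mono_right (b := 2) h2; omega)
  rw [subtreeSize]
  omega

/-! ### The walk -/

/-- The state of the walk at the head of the main loop. The mode tells what is done next with the
node: `0` process it, `1` try the left child, `2` try the right child, `3` return to the parent. -/
structure Walk (n : ℕ) where
  node : ℕ
  mode : ℕ
  count : ℕ
  output : List (Fin n)

/-- The walk is at a node whose cell meets the query range. -/
def Walk.Valid {k n : ℕ} (P : Fin n → Fin k → ℝ) (α β : Fin k → ℝ) (w : Walk n) : Prop :=
  (1 ≤ w.node ∧ w.node ≤ n) ∧ Good P α β w.node ∧ w.mode ≤ 3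

/-- The initial state of the walk. -/
def Walk.start (n : ℕ) : Walk n := ⟨1, 0, 0, []⟩

theorem Walk.valid_start {k n : ℕ} {P : Fin n → Fin k → ℝ} {α β : Fin k → ℝ} (hn : 1 ≤ n) : (Walk.start n).Valid P α β :=
  ⟨⟨le_rfl, hn⟩, good_root le_rfl, Nat.zero_le _⟩

section

variable {k n : ℕ} [NeZero k] (prune : Bool) (P : Fin n → Fin k → ℝ) (α β : Fin k → ℝ)

/-- The walk enters the child of `t` on side `s`. -/
def Enters (t : ℕ) (s : Side) : Prop :=
  child t s ≤ n ∧ s.le (pt P t (dir k t)) (endpoint α β s.opp (dir k t))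

/-- The subtree of `t` is counted as a whole. -/
def Pruned (t : ℕ) : Prop :=
  prune = true ∧ ∀ i s, origin P α β t i s ≠ 0

namespace Walk

open Classical in
/-- Enter a child or skip it. -/
noncomputable def tryChild (w : Walk n) (s : Side) : Walk n :=
  if Enters P α β w.node s then { w with node := child w.node s, mode := 0 }
  else { w with mode := w.mode + 1 }

/-- What is reported at node `t`. -/
def report (t : ℕ) : List (Fin n) :=
  if prune = true then [] else (node? n t).toList

open Classical in
/-- Process the current node. -/
noncomputable def process (w : Walk n) : Walk n :=
  if Pruned prune P α β w.node then
    { w with mode := 3, count := w.count + subtreeSize n w.node }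
  else if InRange P α β w.node then
    { w with mode := 1, count := w.count + 1, output := w.output ++ report prune w.node }
  else { w with mode := 1 }

/-- Return to the parent; the walk ends at the root. -/
def ascend (w : Walk n) : Walk n :=
  -- The parity replaces a return address: after a left child (even) the right child is next, after
  -- a right child (odd) the parent is finished.
  if w.node ≤ 1 then w else { w with node := w.node / 2, mode := 2 + w.node % 2 }

/-- One round of the main loop. -/
noncomputable def next (w : Walk n) : Walk n :=
  match w.mode with
  | 0 => w.process prune P α β
  | 1 => w.tryChild P α β .upper
  | 2 => w.tryChild P α β .lower
  | _ => w.ascend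

end Walk

open Classical in
/-- The indicator of the nodes that the walk visits. -/
noncomputable def visited (v : ℕ) : ℕ :=
  if Good P α β v ∧ (v ≤ 1 ∨ ¬ Pruned prune P α β (v / 2)) then 1 else 0

open Classical in
/-- The indicator of the nodes whose points lie in the query range. -/
noncomputable def hit (v : ℕ) : ℕ := if InRange P α β v then 1 else 0

variable {prune P α β}

namespace Walk

theorem Valid.next (hP : IsKDTree P) {w : Walk n} (h : w.Valid P α β) :
    (w.next prune P α β).Valid P α β := by
  obtain ⟨t, mode, c, o⟩ := w
  obtain ⟨⟨h1, h2⟩, h3, h4⟩ := h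
  simp only at h1 h2 h3 h4
  have htry : ∀ s, mode ≤ 2 → ((⟨t, mode, c, o⟩ : Walk n).tryChild P α β s).Valid P α β := by
    intro s hm
    rw [tryChild]
    split_ifs with he
    · have := lt_child h1 s
      exact ⟨⟨by simp only; omega, he.1⟩, good_child h1 h2 s h3 he.2, Nat.zero_le _⟩
    · exact ⟨⟨h1, h2⟩, h3, by simp only; omega⟩
  rw [Walk.next]
  split
  · rw [process]
    split_ifs
    · exact ⟨⟨h1, h2⟩, h3, le_rfl⟩
    · exact ⟨⟨h1, h2⟩, h3, by simp⟩
    · exact ⟨⟨h1, h2⟩, h3, by simp⟩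
  · exact htry _ (by simp_all)
  · exact htry _ (by simp_all)
  · rw [ascend]
    split_ifs with ht
    · exact ⟨⟨h1, h2⟩, h3, h4⟩
    · obtain ⟨p, s, hp, rfl⟩ := exists_eq_child (t := t) (by simp only at ht; omega)
      have := lt_child hp s
      refine ⟨⟨?_, ?_⟩, ?_, ?_⟩
      · simp only [child_div]; omega
      · simp only [child_div]; omega
      · simp only [child_div]
        exact h3.of_child hP hp (by omega)
      · simp only; omega

theorem valid_iterate (hP : IsKDTree P) (hn : 1 ≤ n) (m : ℕ) :
    ((next prune P α β)^[m] (start n)).Valid P α β := by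
  induction m with
  | zero => exact valid_start hn
  | succ m ih =>
    rw [Function.iterate_succ_apply']
    exact ih.next hP

theorem count_le_next (w : Walk n) : w.count ≤ (w.next prune P α β).count := by
  rw [next]
  split
  · rw [process]
    split_ifs <;> simp
  · rw [tryChild]
    split_ifs <;> simp
  · rw [tryChild]
    split_ifs <;> simp
  · rw [ascend]
    split_ifs <;> simp

/-- Bounds the result register throughout the run by its final value. -/
theorem count_mono (w : Walk n) : Monotone fun m => ((next prune P α β)^[m] w).count :=
  monotone_nat_of_le_succ fun m => by
    rw [Function.iterate_succ_apply']
    exact count_le_next _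

open Classical in
theorem count_report (hprune : prune = false) {t : ℕ} (h1 : 1 ≤ t) (h2 : t ≤ n) (j : Fin n) :
    (report prune t : List (Fin n)).count j = if t = j + 1 then 1 else 0 := by
  have : (node? n t).toList = [⟨t - 1, by omega⟩] := by simp [node?, h1, h2]
  rw [report, if_neg (by simp [hprune]), this, List.count_singleton]
  refine if_congr ?_ rfl rfl
  rw [beq_iff_eq, Fin.ext_iff]
  simp only
  omega

/-- The walk traverses a subtree from mode `0` to mode `3`. -/
theorem traverse (hP : IsKDTree P) {t : ℕ} (h1 : 1 ≤ t) (h2 : t ≤ n) (hg : Good P α β t)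
    (hv : t ≤ 1 ∨ ¬ Pruned prune P α β (t / 2)) (c : ℕ) (o : List (Fin n)) :
    ∃ N c' o', (next prune P α β)^[N] ⟨t, 0, c, o⟩ = ⟨t, 3, c', o'⟩ ∧
      N ≤ 5 * ∑ v ∈ subtree n t, visited prune P α β v ∧
      c' = c + ∑ v ∈ subtree n t, hit P α β v ∧
      (prune = false → ∀ j, o'.count j = o.count j +
        ∑ v ∈ subtree n t, if v = j + 1 then hit P α β v else 0) := by
  classical
  -- Node numbers increase towards the leaves, so `n - t` decreases.
  induction hN : n - t using Nat.strong_induction_on generalizing t c o with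
  | _ N ih =>
    subst hN
    have hvis : visited prune P α β t = 1 := if_pos ⟨hg, hv⟩
    by_cases hpr : Pruned prune P α β t
    · refine ⟨1, c + subtreeSize n t, o, ?_, ?_, ?_, ?_⟩
      · rw [Function.iterate_one, next]
        exact if_pos hpr
      · rw [sum_subtree h1 h2]
        omega
      · rw [← sum_subtree_one h1 h2]
        -- All facets meet the query range, so every node of the subtree is a hit and the hits add
        -- up to the size of the subtree.
        congr 1
        refine Finset.sum_congr rfl fun v hv => ?_
        obtain ⟨⟨hv1, hv2⟩, m, hm⟩ := mem_subtree.1 hv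
        refine (if_pos ?_).symm
        exact hP.inRange_of_inBand h1 hv1 hv2 hm fun i s =>
          (origin_ne_zero_iff hP h2 hg i s).1 (hpr.2 i s)
      · intro h
        rw [h] at hpr
        exact absurd hpr.1 (by simp)
    · have hchild : ∀ (s : Side) (c : ℕ) (o : List (Fin n)), ∃ N c' o',
          (next prune P α β)^[N] ⟨t, 1 + s.bit, c, o⟩ = ⟨t, 2 + s.bit, c', o'⟩ ∧
          -- One round enters the child and one returns from it. Two children and the round that
          -- processes `t` give the factor `5` per visited node.
          N ≤ 2 + 5 * ∑ v ∈ subtree n (child t s), visited prune P α β v ∧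
          c' = c + ∑ v ∈ subtree n (child t s), hit P α β v ∧
          (prune = false → ∀ j, o'.count j = o.count j +
            ∑ v ∈ subtree n (child t s), if v = j + 1 then hit P α β v else 0) := by
        intro s c o
        have hnext : next prune P α β ⟨t, 1 + s.bit, c, o⟩ =
            tryChild P α β ⟨t, 1 + s.bit, c, o⟩ s := by
          cases s <;> rfl
        by_cases he : Enters P α β t s
        · have hlt := lt_child h1 s
          obtain ⟨N, c', o', hN, hle, hc, ho⟩ := ih (n - child t s) (by have := he.1; omega)
            (t := child t s) (by omega) he.1 (good_child h1 h2 s hg he.2)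
            (Or.inr (by rwa [child_div])) c o rfl
          refine ⟨1 + (N + 1), c', o', ?_, by omega, hc, ho⟩
          rw [Function.iterate_add_apply, Function.iterate_add_apply, Function.iterate_one, hnext,
            tryChild, if_pos he]
          simp only
          rw [hN, next, ascend, if_neg (by simp only; omega)]
          simp only [child_div, Walk.mk.injEq, and_true, true_and]
          cases s <;> simp only [child, Side.bit] <;> omega
        · have hzero : ∀ v ∈ subtree n (child t s), hit P α β v = 0 := by
            intro v hv
            obtain ⟨⟨hv1, hv2⟩, m, hm⟩ := mem_subtree.1 hv
            refine if_neg (hP.not_inRange h1 hv1 hv2 hm fun hs => he ⟨?_, hs⟩)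
            have := Nat.div_le_self v (2 ^ m)
            omega
          refine ⟨1, c, o, ?_, by omega, ?_, fun _ j => ?_⟩
          · rw [Function.iterate_one, hnext, tryChild, if_neg he]
            simp only [Walk.mk.injEq, and_true, true_and]
            omega
          · rw [Finset.sum_eq_zero hzero, add_zero]
          · rw [Finset.sum_eq_zero, add_zero]
            intro v hv
            rw [hzero v hv, ite_self]
      set o₁ := if InRange P α β t then o ++ report prune t else o with ho₁
      obtain ⟨N₁, c₂, o₂, hN₁, hle₁, hc₂, ho₂⟩ := hchild .upper (c + hit P α β t) o₁
      obtain ⟨N₂, c₃, o₃, hN₂, hle₂, hc₃, ho₃⟩ := hchild .lower c₂ o₂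
      refine ⟨N₂ + (N₁ + 1), c₃, o₃, ?_, ?_, ?_, ?_⟩
      · rw [Function.iterate_add_apply, Function.iterate_add_apply, Function.iterate_one]
        have : next prune P α β ⟨t, 0, c, o⟩ = ⟨t, 1, c + hit P α β t, o₁⟩ := by
          rw [next, process, if_neg hpr, hit, ho₁]
          simp only
          split_ifs <;> rfl
        rw [this]
        exact (congrArg _ hN₁).trans hN₂
      · rw [sum_subtree h1 h2, hvis]
        omega
      · rw [sum_subtree h1 h2, hc₃, hc₂]
        ring
      · intro hprune j
        rw [sum_subtree h1 h2, ho₃ hprune, ho₂ hprune, ← add_assoc, ← add_assoc]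
        congr 2
        rw [ho₁, hit]
        split_ifs with ha hb hb
        · rw [List.count_append, count_report hprune h1 h2, if_pos hb]
        · rw [List.count_append, count_report hprune h1 h2, if_neg hb]
        · rfl
        · rfl

end Walk

end

/-! ### The program -/

/-- The word registers. -/
inductive Reg (k : ℕ) where
  | cur | lev | wid | mode | out | one | two | kk | nn | tmp | aux | bit | old
  | dep (i : Fin k) (s : Side)

/-- The loops: initialization, the computation of the width of the last level, the main loop. -/
inductive Loop where
  | start | init | head

theorem finite_reg (k : ℕ) : Finite (Reg k) := by
  refine Finite.of_surjective (fun x : Fin 13 ⊕ Fin k × Side => match x with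
    | .inl a => (![.cur, .lev, .wid, .mode, .out, .one, .two, .kk, .nn, .tmp, .aux, .bit, .old] :
        Fin 13 → Reg k) a
    | .inr (i, s) => .dep i s) fun r => ?_
  cases r with
  | cur => exact ⟨.inl 0, rfl⟩
  | lev => exact ⟨.inl 1, rfl⟩
  | wid => exact ⟨.inl 2, rfl⟩
  | mode => exact ⟨.inl 3, rfl⟩
  | out => exact ⟨.inl 4, rfl⟩
  | one => exact ⟨.inl 5, rfl⟩
  | two => exact ⟨.inl 6, rfl⟩
  | kk => exact ⟨.inl 7, rfl⟩
  | nn => exact ⟨.inl 8, rfl⟩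
  | tmp => exact ⟨.inl 9, rfl⟩
  | aux => exact ⟨.inl 10, rfl⟩
  | bit => exact ⟨.inl 11, rfl⟩
  | old => exact ⟨.inl 12, rfl⟩
  | dep i s => exact ⟨.inr (i, s), rfl⟩

theorem finite_loop : Finite Loop := by
  refine Finite.of_surjective (![.start, .init, .head] : Fin 3 → Loop) fun l => ?_
  cases l with
  | start => exact ⟨0, rfl⟩
  | init => exact ⟨1, rfl⟩
  | head => exact ⟨2, rfl⟩

section Codes

open Code Reg

variable (k : ℕ)

/-- Clear the scratch registers and return to the head of the main loop. -/
def backCode : Code k Loop (Reg k) :=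
  const tmp 0 (const aux 0 (const bit 0 (const old 0 (goto .head))))

variable {k}

/-- Branch on the value of the register `tmp`. -/
def dispatch (f : Fin k → Code k Loop (Reg k)) (l : List (Fin k)) : Code k Loop (Reg k) :=
  l.foldr (fun (i : Fin k) c => const aux (i : ℕ) (ifLe aux tmp (ifLe tmp aux (f i) c) c)) (backCode k)

/-- Branch on the splitting coordinate of the level in the register `lev`. -/
def splitCode (f : Fin k → Code k Loop (Reg k)) : Code k Loop (Reg k) :=
  arith .div tmp lev kk (arith .mul tmp tmp kk (arith .sub tmp lev tmp
    (dispatch f (List.finRange k))))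

/-- Test whether all listed tuple entries are non-NULL. -/
def allEntries (yes no : Code k Loop (Reg k)) (l : List (Fin k × Side)) : Code k Loop (Reg k) :=
  l.foldr (fun p c => ifNull p.1 p.2 no c) yes

/-- Test whether the current point lies in the query range, for the listed coordinates. -/
def allInRange (yes no : Code k Loop (Reg k)) (l : List (Fin k)) : Code k Loop (Reg k) :=
  l.foldr (fun i c => ifCoordLe (.queryLower i) (.point i)
    (ifCoordLe (.point i) (.queryUpper i) c no) no) yes

/-- Test whether the current point is on the inner side of the endpoint opposite to `s`. -/
def entersCode (s : Side) (i : Fin k) (yes no : Code k Loop (Reg k)) : Code k Loop (Reg k) :=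
  match s with
  | .lower => ifCoordLe (.point i) (.queryUpper i) yes no
  | .upper => ifCoordLe (.queryLower i) (.point i) yes no

variable (k) in
/-- Move to the child in the register `old`. -/
def descendCode : Code k Loop (Reg k) :=
  -- Multiplication by the constant register `one` copies a register.
  arith .mul cur old one (arith .add lev lev one (arith .div wid wid two
    (const mode 0 (backCode k))))

/-- Enter the child on side `s` or skip it. -/
def childCode (s : Side) : Code k Loop (Reg k) :=
  const bit s.bit (arith .add old cur cur (arith .add old old bit (splitCode fun i =>
    ifLe old nn
      (entersCode s i
        -- The child meets the query range. Its new facet needs an entry only if none is inherited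
        -- and the split value also lies on the inner side of the endpoint on side `s`. The value is
        -- stored while the parent is still current, since it is a coordinate of the parent's point.
        (ifNull i s
          (entersCode s.opp i
            (store i s (arith .mul (dep i s) old one (descendCode k)))
            (descendCode k))
          (descendCode k))
        (arith .add mode mode one (backCode k)))
      (arith .add mode mode one (backCode k)))))

/-- Process the current node. -/
def processCode (prune : Bool) : Code k Loop (Reg k) :=
  let point : Code k Loop (Reg k) := allInRange
    (arith .add out out one
      (if prune = true then const mode 1 (backCode k) else emit (const mode 1 (backCode k))))
    (const mode 1 (backCode k)) (List.finRange k)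
  let whole : Code k Loop (Reg k) := arith .add out out wid (arith .sub out out one
    (const mode 3 (backCode k)))
  if prune = true then
    allEntries
      -- The formula for `subtreeSize`: `aux` becomes `n + 1 - cur * wid`, the comparison takes its
      -- minimum with `wid`, and `whole` adds `wid - 1`.
      (arith .mul tmp cur wid (arith .add aux nn one (arith .sub aux aux tmp
        (ifLe aux wid (arith .add out out aux whole) (arith .add out out wid whole)))))
      point ((List.finRange k).flatMap fun i => [(i, .lower), (i, .upper)])
  else point

/-- Forget the facet `(i, s)` if it appeared at the node in the register `old`. -/
def eraseCode (i : Fin k) (s : Side) : Code k Loop (Reg k) :=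
  -- An origin never exceeds the node being left, so the inequality is a test for equality.
  ifLe old (dep i s) (const (dep i s) 0 (clear i s (backCode k))) (backCode k)

/-- Return to the parent. -/
def ascendCode : Code k Loop (Reg k) :=
  ifLe cur one halt
    (arith .mul old cur one (arith .div cur cur two (arith .mul tmp cur two
      (arith .sub bit old tmp (arith .add mode two bit (arith .sub lev lev one
        -- The level has already been lowered, so the coordinate found is the one in which the
        -- parent splits: only that facet may have to be forgotten.
        (arith .mul wid wid two (splitCode fun i =>
          ifLe one bit (eraseCode i .lower) (eraseCode i .upper)))))))))

/-- One round of the main loop. -/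
def headCode (prune : Bool) : Code k Loop (Reg k) :=
  -- At the head `tmp` is `0`, because every round clears the scratch registers; it serves as the
  -- constant zero.
  ifLe mode tmp (processCode prune) (ifLe mode one (childCode .upper)
    (ifLe mode two (childCode .lower) ascendCode))

/-- Initialization of the constants. -/
def startCode : Code k Loop (Reg k) :=
  const one 1 (const two 2 (const kk k (size nn (const wid 1 (goto .init)))))

/-- Computation of the largest power of two that is at most `n`. -/
def initCode : Code k Loop (Reg k) :=
  arith .mul tmp wid two (ifLe tmp nn
    (arith .mul wid tmp one (const tmp 0 (goto .init)))
    (const cur 1 (const tmp 0 (goto .head))))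

end Codes

/-- The program for counting (`prune = true`) and the program for reporting (`prune = false`). -/
def treeProgram (k : ℕ) (prune : Bool) : LoopProgram k where
  L := Loop
  W := Reg k
  finite_loops := finite_loop
  finite_registers := finite_reg k
  start := .start
  head := .head
  cur := .cur
  out := .out
  body
    | .start => startCode
    | .init => initCode
    | .head => headCode prune
  body_not_leaf l := by
    cases l <;> exact id

/-! ### Execution of the loop bodies -/

section Exec

variable {k n : ℕ}

open Classical in
/-- Assign a register. -/
noncomputable def Store.set (σ : Store k n (Reg k)) (r : Reg k) (x : ℕ) : Store k n (Reg k) :=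
  { σ with reg := Function.update σ.reg r x }

open Classical in
/-- Assign a tuple entry. -/
noncomputable def Store.setEntry (σ : Store k n (Reg k)) (i : Fin k) (s : Side) (x : Option ℝ) :
    Store k n (Reg k) :=
  { σ with tuple := fun i' s' => if i' = i ∧ s' = s then x else σ.tuple i' s' }

open Classical in
theorem Store.set_reg (σ : Store k n (Reg k)) (r r' : Reg k) (x : ℕ) :
    (σ.set r x).reg r' = if r' = r then x else σ.reg r' :=
  by simp only [Store.set, Function.update_apply]

theorem Store.set_tuple (σ : Store k n (Reg k)) (r : Reg k) (x : ℕ) :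
    (σ.set r x).tuple = σ.tuple := rfl

theorem Store.set_output (σ : Store k n (Reg k)) (r : Reg k) (x : ℕ) :
    (σ.set r x).output = σ.output := rfl

theorem Store.setEntry_reg (σ : Store k n (Reg k)) (i : Fin k) (s : Side) (x : Option ℝ) :
    (σ.setEntry i s x).reg = σ.reg := rfl

theorem Store.setEntry_output (σ : Store k n (Reg k)) (i : Fin k) (s : Side) (x : Option ℝ) :
    (σ.setEntry i s x).output = σ.output := rfl

open Classical in
theorem Store.setEntry_tuple (σ : Store k n (Reg k)) (i i' : Fin k) (s s' : Side)
    (x : Option ℝ) :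
    (σ.setEntry i s x).tuple i' s' = if i' = i ∧ s' = s then x else σ.tuple i' s' := rfl

theorem Store.set_set (σ : Store k n (Reg k)) (r : Reg k) (x y : ℕ) :
    (σ.set r x).set r y = σ.set r y := by
  simp [Store.set]

variable {P : Fin n → Fin k → ℝ} {α β : Fin k → ℝ}

theorem Store.coord_point {σ : Store k n (Reg k)} {t : ℕ} (h : σ.reg .cur = t) (h1 : 1 ≤ t)
    (h2 : t ≤ n) (i : Fin k) : σ.coord .cur P α β (.point i) = some (pt P t i) := by
  rw [Store.coord, h, coord?_eq P h1 h2]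

theorem Store.coord_lower {σ : Store k n (Reg k)} (i : Fin k) :
    σ.coord .cur P α β (.queryLower i) = some (α i) := rfl

theorem Store.coord_upper {σ : Store k n (Reg k)} (i : Fin k) :
    σ.coord .cur P α β (.queryUpper i) = some (β i) := rfl

variable (σ : Store k n (Reg k))

theorem exec_const (r : Reg k) (c : ℕ) (next : Code k Loop (Reg k)) :
    (Code.const r c next).exec .cur P α β σ = next.exec .cur P α β (σ.set r c) := rfl

theorem exec_size (r : Reg k) (next : Code k Loop (Reg k)) :
    (Code.size r next).exec .cur P α β σ = next.exec .cur P α β (σ.set r n) := rfl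

theorem exec_arith (op : WordOp) (r a b : Reg k) (next : Code k Loop (Reg k)) :
    (Code.arith op r a b next).exec .cur P α β σ =
      next.exec .cur P α β (σ.set r (op.eval (σ.reg a) (σ.reg b))) := rfl

theorem exec_ifLe (a b : Reg k) (yes no : Code k Loop (Reg k)) :
    (Code.ifLe a b yes no).exec .cur P α β σ =
      if σ.reg a ≤ σ.reg b then yes.exec .cur P α β σ else no.exec .cur P α β σ := rfl

theorem exec_store (i : Fin k) (s : Side) (next : Code k Loop (Reg k)) :
    (Code.store i s next).exec .cur P α β σ =
      next.exec .cur P α β (σ.setEntry i s (coord? P (σ.reg .cur) i)) := rfl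

theorem exec_clear (i : Fin k) (s : Side) (next : Code k Loop (Reg k)) :
    (Code.clear i s next).exec .cur P α β σ = next.exec .cur P α β (σ.setEntry i s none) := rfl

open Classical in
theorem exec_ifNull (i : Fin k) (s : Side) (yes no : Code k Loop (Reg k)) :
    (Code.ifNull i s yes no).exec .cur P α β σ =
      if σ.tuple i s = none then yes.exec .cur P α β σ else no.exec .cur P α β σ := rfl

theorem exec_ifCoordLe {x y : CoordArg k} {a b : ℝ} (hx : σ.coord .cur P α β x = some a)
    (hy : σ.coord .cur P α β y = some b) (yes no : Code k Loop (Reg k)) :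
    (Code.ifCoordLe x y yes no).exec .cur P α β σ =
      if a ≤ b then yes.exec .cur P α β σ else no.exec .cur P α β σ := by
  classical
  refine if_congr ?_ rfl rfl
  simp [hx, hy]

theorem exec_emit (next : Code k Loop (Reg k)) :
    (Code.emit next).exec .cur P α β σ = next.exec .cur P α β
      { σ with output := σ.output ++ (node? n (σ.reg .cur)).toList } := rfl

theorem exec_back : (backCode k).exec .cur P α β σ =
    ((((σ.set .tmp 0).set .aux 0).set .bit 0).set .old 0, some .head) := rfl

theorem exec_dispatch (f : Fin k → Code k Loop (Reg k)) {i : Fin k} (l : List (Fin k))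
    (hi : i ∈ l) (hσ : σ.reg .tmp = i) :
    (dispatch f l).exec .cur P α β σ = (f i).exec .cur P α β (σ.set .aux i) := by
  induction l generalizing σ with
  | nil => cases hi
  | cons j l ih =>
    rw [dispatch, List.foldr_cons, ← dispatch, exec_const, exec_ifLe, exec_ifLe]
    have h1 : (σ.set .aux j).reg .aux = j := by simp [Store.set_reg]
    have h2 : (σ.set .aux j).reg .tmp = i := by simp [Store.set_reg, hσ]
    rw [h1, h2]
    by_cases hij : i = j
    · subst hij
      simp
    · have hne : (i : ℕ) ≠ j := fun h => hij (Fin.ext h)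
      have := ih (σ.set .aux j) ((List.mem_cons.1 hi).resolve_left hij) h2
      rw [Store.set_set] at this
      rw [this]
      split_ifs
      · omega
      · rfl
      · rfl

theorem exec_split [NeZero k] (f : Fin k → Code k Loop (Reg k)) {t : ℕ}
    (hk : σ.reg .kk = k) (ht : σ.reg .lev = Nat.log 2 t) :
    (splitCode f).exec .cur P α β σ = (f (dir k t)).exec .cur P α β
      ((σ.set .tmp (Nat.log 2 t % k)).set .aux (Nat.log 2 t % k)) := by
  have h : Nat.log 2 t - Nat.log 2 t / k * k = Nat.log 2 t % k := by
    have := Nat.div_add_mod' (Nat.log 2 t) k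
    omega
  simp only [splitCode, exec_arith, Store.set_set, Store.set_reg, WordOp.eval, reduceCtorEq,
    if_false, if_true, hk, ht, h]
  exact exec_dispatch _ f (List.finRange k) (List.mem_finRange (dir k t))
    (by simp [Store.set_reg, dir])

open Classical in
theorem exec_allEntries (yes no : Code k Loop (Reg k)) (l : List (Fin k × Side)) :
    (allEntries yes no l).exec .cur P α β σ =
      if ∀ p ∈ l, σ.tuple p.1 p.2 ≠ none then yes.exec .cur P α β σ
      else no.exec .cur P α β σ := by
  induction l with
  | nil => simp [allEntries]
  | cons p l ih =>
    rw [allEntries, List.foldr_cons, ← allEntries, exec_ifNull, ih]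
    simp only [List.forall_mem_cons]
    split_ifs <;> simp_all

open Classical in
theorem exec_allInRange (yes no : Code k Loop (Reg k)) {t : ℕ} (h : σ.reg .cur = t) (h1 : 1 ≤ t)
    (h2 : t ≤ n) (l : List (Fin k)) :
    (allInRange yes no l).exec .cur P α β σ =
      if ∀ i ∈ l, α i ≤ pt P t i ∧ pt P t i ≤ β i then yes.exec .cur P α β σ
      else no.exec .cur P α β σ := by
  induction l with
  | nil => simp [allInRange]
  | cons i l ih =>
    change (Code.ifCoordLe (.queryLower i) (.point i) (Code.ifCoordLe (.point i) (.queryUpper i)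
      (allInRange yes no l) no) no).exec .cur P α β σ = _
    rw [exec_ifCoordLe σ (Store.coord_lower i) (Store.coord_point h h1 h2 i),
      exec_ifCoordLe σ (Store.coord_point h h1 h2 i) (Store.coord_upper i), ih]
    simp only [List.forall_mem_cons]
    split_ifs <;> simp_all

open Classical in
theorem exec_enters (s : Side) (i : Fin k) (yes no : Code k Loop (Reg k)) {t : ℕ}
    (h : σ.reg .cur = t) (h1 : 1 ≤ t) (h2 : t ≤ n) :
    (entersCode s i yes no).exec .cur P α β σ =
      if s.le (pt P t i) (endpoint α β s.opp i) then yes.exec .cur P α β σ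
      else no.exec .cur P α β σ := by
  cases s
  · rw [entersCode, exec_ifCoordLe σ (Store.coord_point h h1 h2 i) (Store.coord_upper i)]
    exact if_congr Iff.rfl rfl rfl
  · rw [entersCode, exec_ifCoordLe σ (Store.coord_lower i) (Store.coord_point h h1 h2 i)]
    exact if_congr Iff.rfl rfl rfl

end Exec

/-! ### The program simulates the walk -/

section Simulation

variable {k n : ℕ} (P : Fin n → Fin k → ℝ) (α β : Fin k → ℝ)

/-- The store at the head of the main loop. -/
noncomputable def Walk.toStore (w : Walk n) : Store k n (Reg k) where
  reg
    | .cur => w.node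
    | .lev => Nat.log 2 w.node
    | .wid => 2 ^ (Nat.log 2 n - Nat.log 2 w.node)
    | .mode => w.mode
    | .out => w.count
    | .one => 1
    | .two => 2
    | .kk => k
    | .nn => n
    | .tmp | .aux | .bit | .old => 0
    | .dep i s => origin P α β w.node i s
  tuple := entryAt P α β w.node
  output := w.output

variable {P α β}

theorem Store.ext_iff' {σ τ : Store k n (Reg k)} : σ = τ ↔
    (∀ r, σ.reg r = τ.reg r) ∧ (∀ i s, σ.tuple i s = τ.tuple i s) ∧ σ.output = τ.output := by
  constructor
  · rintro rfl
    exact ⟨fun _ => rfl, fun _ _ => rfl, rfl⟩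
  · rintro ⟨h1, h2, h3⟩
    exact Store.ext (funext h1) (funext fun i => funext (h2 i)) h3

theorem exec_descend {P : Fin n → Fin k → ℝ} (σ : Store k n (Reg k)) :
    (descendCode k).exec .cur P α β σ = ((backCode k).exec .cur P α β
      ((((σ.set .cur (σ.reg .old * σ.reg .one)).set .lev (σ.reg .lev + σ.reg .one)).set .wid
        (σ.reg .wid / σ.reg .two)).set .mode 0)) := by
  simp [descendCode, exec_arith, exec_const, WordOp.eval, Store.set_reg]

theorem exec_erase {P : Fin n → Fin k → ℝ} (σ : Store k n (Reg k)) (i : Fin k) (s : Side) :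
    (eraseCode i s).exec .cur P α β σ = (backCode k).exec .cur P α β
      (if σ.reg .old ≤ σ.reg (.dep i s) then (σ.set (.dep i s) 0).setEntry i s none else σ) := by
  rw [eraseCode, exec_ifLe, exec_const, exec_clear]
  split_ifs <;> rfl

variable {prune : Bool}

theorem exec_head_final {w : Walk n} (h3 : w.mode = 3) (h1 : w.node = 1) :
    (headCode prune).exec .cur P α β (w.toStore P α β) = (w.toStore P α β, none) := by
  have h0 : (w.toStore P α β).reg .mode = 3 := h3
  have h2 : (w.toStore P α β).reg .cur = 1 := h1
  rw [headCode, exec_ifLe, if_neg (by rw [h0]; exact Nat.not_succ_le_zero 2), exec_ifLe,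
    if_neg (by rw [h0]; change ¬ (3 ≤ 1); omega), exec_ifLe,
    if_neg (by rw [h0]; change ¬ (3 ≤ 2); omega), ascendCode, exec_ifLe,
    if_pos (by rw [h2]; exact le_rfl)]
  rfl

/-- The store during the initialization. -/
noncomputable def initStore (k n j : ℕ) : Store k n (Reg k) where
  reg
    | .wid => 2 ^ j
    | .one => 1
    | .two => 2
    | .kk => k
    | .nn => n
    | _ => 0
  tuple := fun _ _ => none
  output := []

theorem exec_startCode : startCode.exec .cur P α β
    (⟨fun _ => 0, fun _ _ => none, []⟩ : Store k n (Reg k)) =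
      (initStore k n 0, some .init) := by
  rw [startCode, exec_const, exec_const, exec_const, exec_size, exec_const]
  refine Prod.ext (Store.ext_iff'.2 ⟨fun r => ?_, fun i s => rfl, rfl⟩) rfl
  cases r <;> simp [Code.exec, Store.set_reg, initStore]

theorem exec_initCode_of_le {j : ℕ} (h : 2 ^ (j + 1) ≤ n) :
    initCode.exec .cur P α β (initStore k n j) = (initStore k n (j + 1), some .init) := by
  rw [initCode, exec_arith, exec_ifLe, if_pos, exec_arith, exec_const]
  · refine Prod.ext (Store.ext_iff'.2 ⟨fun r => ?_, fun i s => rfl, rfl⟩) rfl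
    cases r <;> simp [Code.exec, Store.set_reg, initStore, WordOp.eval, pow_succ]
  · simpa [Store.set_reg, initStore, WordOp.eval, pow_succ] using h

theorem exec_initCode_log : initCode.exec .cur P α β (initStore k n (Nat.log 2 n)) =
    ((Walk.start n).toStore P α β, some .head) := by
  have h := Nat.lt_pow_succ_log_self (b := 2) (by norm_num) n
  rw [initCode, exec_arith, exec_ifLe, if_neg, exec_const, exec_const]
  · refine Prod.ext (Store.ext_iff'.2 ⟨fun r => ?_, fun i s => ?_, rfl⟩) rfl
    · cases r <;>
        simp [Code.exec, Store.set_reg, initStore, Walk.toStore, Walk.start, origin_of_le_one]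
    · simp [Code.exec, Store.set_tuple, initStore, Walk.toStore, Walk.start, origin_of_le_one,
        entryAt]
  · simpa [Store.set_reg, initStore, WordOp.eval, pow_succ] using h

variable [NeZero k]

/-- The origin of a facet of a child. -/
theorem origin_child_eq (hP : IsKDTree P) {t : ℕ} (h1 : 1 ≤ t) (h2 : t ≤ n) (hg : Good P α β t)
    {s : Side} {i : Fin k} {s' : Side} (h : i = dir k t ∧ s' = s → origin P α β t i s' = 0 →
      ¬ s.le (endpoint α β s i) (pt P t i)) :
    origin P α β (child t s) i s' = origin P α β t i s' := by
  rw [origin_child h1]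
  by_cases ho : origin P α β t i s' = 0
  · rw [if_neg (not_not.2 ho), if_neg, ho]
    by_cases hi : i = dir k t ∧ s' = s
    · have := h hi ho
      obtain ⟨rfl, rfl⟩ := hi
      rintro ⟨c, hc, hc', -⟩
      rw [cellBound_child_self P h1 h2] at hc
      cases hc
      exact this hc'
    · rw [InBand, cellBound_child_of_ne P h1 hi]
      have := mt (origin_ne_zero_iff hP h2 hg i s').2 (not_not.2 ho)
      exact this
  · rw [if_pos ho]

theorem origin_child_new {t : ℕ} (h1 : 1 ≤ t) (h2 : t ≤ n) {s : Side}
    (ho : origin P α β t (dir k t) s = 0)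
    (he : s.le (pt P t (dir k t)) (endpoint α β s.opp (dir k t)))
    (h : s.le (endpoint α β s (dir k t)) (pt P t (dir k t))) :
    origin P α β (child t s) (dir k t) s = child t s := by
  rw [origin_child h1, if_neg (not_not.2 ho), if_pos]
  exact ⟨_, cellBound_child_self P h1 h2 s, h, he⟩

/-- The only origin that can change is that of the facet just cut, and it changes exactly when it
was `0` and the split value lies in the query interval. The branches of the code are these cases. -/
theorem exec_child (hP : IsKDTree P) {w : Walk n} (hw : w.Valid P α β) (s : Side) :
    (childCode s).exec .cur P α β (w.toStore P α β) =
      ((w.tryChild P α β s).toStore P α β, some .head) := by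
  classical
  obtain ⟨t, mode, c, o⟩ := w
  obtain ⟨⟨h1, h2⟩, hg, hm⟩ := hw
  simp only at h1 h2 hg hm
  set σ := (⟨t, mode, c, o⟩ : Walk n).toStore P α β with hσ
  have hskip : ∀ σ' : Store k n (Reg k), (∀ r, r ≠ .tmp → r ≠ .aux → r ≠ .bit → r ≠ .old →
      σ'.reg r = σ.reg r) → σ'.tuple = σ.tuple → σ'.output = σ.output → ¬ Enters P α β t s →
      (Code.arith .add .mode .mode .one (backCode k)).exec .cur P α β σ' =
        (((⟨t, mode, c, o⟩ : Walk n).tryChild P α β s).toStore P α β, some .head) := by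
    intro σ' hr ht ho he
    rw [exec_arith, exec_back, Walk.tryChild, if_neg he]
    refine Prod.ext (Store.ext_iff'.2 ⟨fun r => ?_, fun i s => ?_, ?_⟩) rfl
    · cases r <;> simp [Store.set_reg, hr, WordOp.eval] <;> rfl
    · simp only [Store.set_tuple, ht]
      rfl
    · simp only [Store.set_output, ho]
      rfl
  have hdesc : ∀ σ' : Store k n (Reg k), (∀ r, r ≠ .tmp → r ≠ .aux → r ≠ .bit → r ≠ .old →
      (∀ i s, r ≠ .dep i s) → σ'.reg r = σ.reg r) → σ'.reg .old = child t s →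
      (∀ i s', σ'.reg (.dep i s') = origin P α β (child t s) i s') →
      σ'.tuple = entryAt P α β (child t s) → σ'.output = σ.output → Enters P α β t s →
      (descendCode k).exec .cur P α β σ' =
        (((⟨t, mode, c, o⟩ : Walk n).tryChild P α β s).toStore P α β, some .head) := by
    intro σ' hr hold hdep ht ho he
    have hlog := Nat.log_mono_right (b := 2) he.1
    rw [log_child h1] at hlog
    have hwid : 2 ^ (Nat.log 2 n - Nat.log 2 t) / 2 =
        2 ^ (Nat.log 2 n - (Nat.log 2 t + 1)) := by
      rw [show Nat.log 2 n - Nat.log 2 t = Nat.log 2 n - (Nat.log 2 t + 1) + 1 by omega, pow_succ,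
        Nat.mul_div_cancel _ (by norm_num)]
    rw [exec_descend, exec_back, Walk.tryChild, if_pos he]
    refine Prod.ext (Store.ext_iff'.2 ⟨fun r => ?_, fun i s => ?_, ?_⟩) rfl
    · cases r <;> simp [Store.set_reg, hr, hold, hdep, Walk.toStore, hσ, log_child h1, hwid]
    · simp only [Store.set_tuple, ht]
      rfl
    · simp only [Store.set_output, ho]
      rfl
  have hbit : WordOp.add.eval (WordOp.add.eval t t) s.bit = child t s := by
    simp only [WordOp.eval, child]
    omega
  have hstart : (childCode s).exec .cur P α β σ = (splitCode fun i =>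
      Code.ifLe .old .nn
      (entersCode s i
        (.ifNull i s
          (entersCode s.opp i
            (.store i s (.arith .mul (.dep i s) .old .one (descendCode k)))
            (descendCode k))
          (descendCode k))
        (.arith .add .mode .mode .one (backCode k)))
      (.arith .add .mode .mode .one (backCode k))).exec .cur P α β
        ((σ.set .bit s.bit).set .old (child t s)) := by
    rw [childCode, exec_const, exec_arith, exec_arith, Store.set_set]
    simp only [Store.set_reg, reduceCtorEq, if_false, if_true]
    rw [show σ.reg .cur = t from rfl, hbit]
  rw [hstart, exec_split (t := t) ((σ.set .bit s.bit).set .old (child t s)) _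
    (by simp [Store.set_reg, hσ, Walk.toStore]) (by simp [Store.set_reg, hσ, Walk.toStore])]
  set σ' := ((((σ.set .bit s.bit).set .old (child t s)).set .tmp (Nat.log 2 t % k)).set .aux
    (Nat.log 2 t % k)) with hσ'
  have hreg : ∀ r, r ≠ .tmp → r ≠ .aux → r ≠ .bit → r ≠ .old → σ'.reg r = σ.reg r := by
    intro r h1 h2 h3 h4
    simp [hσ', Store.set_reg, h1, h2, h3, h4]
  have hold : σ'.reg .old = child t s := by simp [hσ', Store.set_reg]
  have hcur : σ'.reg .cur = t := by simp [hσ', Store.set_reg, hσ, Walk.toStore]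
  have hnn : σ'.reg .nn = n := by simp [hσ', Store.set_reg, hσ, Walk.toStore]
  rw [exec_ifLe, exec_enters _ _ _ _ _ hcur h1 h2, exec_ifNull, exec_enters _ _ _ _ _ hcur h1 h2,
    hold, hnn]
  split_ifs with ha hb hc hd
  · have ho : origin P α β t (dir k t) s = 0 := (entryAt_eq_none_iff hP h2 hg _ _).1 hc
    rw [Side.opp_opp, Side.opp_le] at hd
    have hnew := origin_child_new h1 h2 ho hb hd
    have hdep : ∀ i s', ¬ (i = dir k t ∧ s' = s) →
        origin P α β (child t s) i s' = origin P α β t i s' := fun i s' h =>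
      origin_child_eq hP h1 h2 hg fun h' => absurd h' h
    rw [exec_store, exec_arith]
    refine hdesc _ ?_ ?_ ?_ ?_ rfl ⟨ha, hb⟩
    · intro r h1 h2 h3 h4 h5
      simp [Store.set_reg, Store.setEntry_reg, h5, hreg r h1 h2 h3 h4]
    · simp [Store.set_reg, Store.setEntry_reg, hold]
    · intro i s'
      rw [Store.set_reg]
      split_ifs with h
      · cases h
        rw [hnew]
        simp [Store.setEntry_reg, hold, WordOp.eval, hreg, hσ, Walk.toStore]
      · rw [hdep i s' (by rintro ⟨rfl, rfl⟩; exact h rfl), Store.setEntry_reg,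
          hreg _ (by simp) (by simp) (by simp) (by simp)]
        rfl
    · funext i s'
      rw [Store.set_tuple, Store.setEntry_tuple, hcur, coord?_eq P h1 h2]
      split_ifs with h
      · obtain ⟨rfl, rfl⟩ := h
        rw [entryAt, hnew, if_neg (by have := lt_child h1 s'; omega),
          cellBound_child_self P h1 h2]
      · rw [entryAt, hdep i s' h]
        rfl
  all_goals try
    refine hskip _ hreg rfl rfl fun he => ?_
    first | exact ha he.1 | exact hb he.2
  -- The two remaining branches descend without a store: the split value misses the query interval,
  -- or an entry is inherited. In both, all origins persist.
  all_goals
    have hdep : ∀ i s', origin P α β (child t s) i s' = origin P α β t i s' := by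
      refine fun i s' => origin_child_eq hP h1 h2 hg ?_
      rintro ⟨rfl, rfl⟩ ho
      first
      | rwa [Side.opp_opp, Side.opp_le] at hd
      | exact absurd ((entryAt_eq_none_iff hP h2 hg _ _).2 ho) hc
    refine hdesc _ (fun r h1 h2 h3 h4 _ => hreg r h1 h2 h3 h4) hold (fun i s' => ?_) ?_ rfl ⟨ha, hb⟩
    · rw [hdep, hreg _ (by simp) (by simp) (by simp) (by simp)]
      rfl
    · funext i s'
      rw [entryAt, hdep]
      rfl

theorem exec_process {w : Walk n} (hw : w.Valid P α β) (hP : IsKDTree P) (hmode : w.mode = 0) :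
    (processCode prune).exec .cur P α β (w.toStore P α β) =
      ((w.process prune P α β).toStore P α β, some .head) := by
  classical
  obtain ⟨t, mode, c, o⟩ := w
  obtain ⟨⟨h1, h2⟩, hg, hm⟩ := hw
  simp only at h1 h2 hg hm hmode
  subst hmode
  set σ := (⟨t, 0, c, o⟩ : Walk n).toStore P α β with hσ
  have hpoint : ¬ Pruned prune P α β t → (allInRange
      (Code.arith .add .out .out .one
        (if prune = true then Code.const .mode 1 (backCode k)
          else .emit (.const .mode 1 (backCode k))))
      (.const .mode 1 (backCode k)) (List.finRange k)).exec .cur P α β σ =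
        (((⟨t, 0, c, o⟩ : Walk n).process prune P α β).toStore P α β, some .head) := by
    intro hpr
    rw [exec_allInRange (t := t) σ _ _ rfl h1 h2, Walk.process, if_neg hpr]
    by_cases hr : InRange P α β t
    · rw [if_pos fun i _ => hr i, if_pos hr, exec_arith]
      cases prune
      · rw [if_neg Bool.false_ne_true, exec_emit, exec_const, exec_back]
        refine Prod.ext (Store.ext_iff'.2 ⟨fun r => ?_, fun i s => rfl, ?_⟩) rfl
        · cases r <;> simp [Store.set_reg, hσ, Walk.toStore, WordOp.eval]
        · simp [Store.set_reg, Store.set_output, hσ, Walk.toStore, Walk.report]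
      · rw [if_pos rfl, exec_const, exec_back]
        refine Prod.ext (Store.ext_iff'.2 ⟨fun r => ?_, fun i s => rfl, ?_⟩) rfl
        · cases r <;> simp [Store.set_reg, hσ, Walk.toStore, WordOp.eval]
        · simp [Store.set_output, hσ, Walk.toStore, Walk.report]
    · rw [if_neg fun h => hr fun i => h i (List.mem_finRange i), if_neg hr, exec_const, exec_back]
      refine Prod.ext (Store.ext_iff'.2 ⟨fun r => ?_, fun i s => rfl, rfl⟩) rfl
      cases r <;> simp [Store.set_reg, hσ, Walk.toStore]
  cases prune
  · exact hpoint fun h => Bool.false_ne_true h.1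
  · rw [processCode, if_pos rfl, exec_allEntries]
    have hiff : (∀ p ∈ (List.finRange k).flatMap fun i => [(i, Side.lower), (i, Side.upper)],
        σ.tuple p.1 p.2 ≠ none) ↔ Pruned true P α β t := by
      have : ∀ i s, σ.tuple i s ≠ none ↔ origin P α β t i s ≠ 0 := fun i s =>
        (entryAt_eq_none_iff hP h2 hg i s).not
      simp only [List.mem_flatMap, List.mem_finRange, true_and, this, Pruned]
      constructor
      · intro h i s
        cases s
        · exact h (i, .lower) ⟨i, by simp⟩
        · exact h (i, .upper) ⟨i, by simp⟩
      · exact fun h p _ => h p.1 p.2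
    by_cases hpr : Pruned true P α β t
    · rw [if_pos (hiff.2 hpr), Walk.process, if_pos hpr]
      have hw := Nat.one_le_two_pow (n := Nat.log 2 n - Nat.log 2 t)
      rw [exec_arith, exec_arith, exec_arith, exec_ifLe]
      split_ifs with hle <;>
        rw [exec_arith, exec_arith, exec_arith, exec_const, exec_back] <;>
        refine Prod.ext (Store.ext_iff'.2 ⟨fun r => ?_, fun i s => rfl, rfl⟩) rfl <;>
        simp [Store.set_reg, hσ, Walk.toStore, WordOp.eval] at hle <;>
        cases r <;> simp [Store.set_reg, hσ, Walk.toStore, WordOp.eval, subtreeSize] <;>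
        omega
    · rw [if_neg (hiff.not.2 hpr)]
      exact hpoint hpr

open Classical in
-- The inverse of a descent. An inherited origin is at most `t` and hence below the number of the
-- child, so the number alone shows whether the facet began to meet the query range at the child.
theorem origin_child_cases {t : ℕ} (h1 : 1 ≤ t) (h2 : t ≤ n) (hP : IsKDTree P)
    (hg : Good P α β t) (s : Side) (i : Fin k) (s' : Side) :
    origin P α β t i s' =
      if i = dir k t ∧ s' = s ∧ child t s ≤ origin P α β (child t s) i s' then 0
      else origin P α β (child t s) i s' := by
  have hle := origin_le (P := P) (α := α) (β := β) t i s'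
  have hlt := lt_child h1 s
  by_cases hi : i = dir k t ∧ s' = s
  · by_cases ho : origin P α β t i s' = 0
    · have := origin_child (P := P) (α := α) (β := β) h1 s i s'
      rw [if_neg (not_not.2 ho)] at this
      rw [ho]
      split_ifs with h
      · rfl
      · by_contra hne
        refine h ⟨hi.1, hi.2, ?_⟩
        split_ifs at this
        · exact this.ge
        · exact absurd this.symm hne
    · rw [origin_child h1, if_pos ho, if_neg]
      omega
  · rw [origin_child_eq hP h1 h2 hg fun h => absurd h hi, if_neg]
    exact fun h => hi ⟨h.1, h.2.1⟩

theorem exec_ascend (hP : IsKDTree P) {w : Walk n} (hw : w.Valid P α β) (hroot : 1 < w.node) :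
    ascendCode.exec .cur P α β (w.toStore P α β) = (w.ascend.toStore P α β, some .head) := by
  classical
  obtain ⟨t, mode, c, o⟩ := w
  obtain ⟨⟨-, h2⟩, hg, hm⟩ := hw
  simp only at h2 hg hm hroot
  obtain ⟨p, s, hp, rfl⟩ := exists_eq_child hroot
  have hlt := lt_child hp s
  have hgp := hg.of_child hP hp (by omega)
  rw [Walk.ascend, if_neg (by simp only; omega)]
  simp only [child_div]
  set σ := (⟨child p s, mode, c, o⟩ : Walk n).toStore P α β with hσ
  have hmod : child p s % 2 = s.bit := by
    have := s.bit_le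
    simp only [child]
    omega
  have hbit : child p s - p * 2 = s.bit := by
    simp only [child]
    omega
  have hlog := Nat.log_mono_right (b := 2) h2
  rw [log_child hp] at hlog
  have hwid : 2 ^ (Nat.log 2 n - (Nat.log 2 p + 1)) * 2 = 2 ^ (Nat.log 2 n - Nat.log 2 p) := by
    rw [← pow_succ]
    congr 1
    omega
  have hfin : ∀ σ' : Store k n (Reg k), (∀ r, r ≠ .cur → r ≠ .lev → r ≠ .wid → r ≠ .mode →
      r ≠ .tmp → r ≠ .aux → r ≠ .bit → r ≠ .old → σ'.reg r = σ.reg r) → σ'.reg .cur = p →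
      σ'.reg .lev = Nat.log 2 p → σ'.reg .wid = 2 ^ (Nat.log 2 n - Nat.log 2 p) →
      σ'.reg .mode = 2 + s.bit → σ'.reg .bit = s.bit → σ'.reg .old = child p s →
      σ'.tuple = σ.tuple → σ'.output = σ.output →
      (Code.ifLe .one .bit (eraseCode (dir k p) .lower) (eraseCode (dir k p) .upper)).exec
        .cur P α β σ' = ((⟨p, 2 + s.bit, c, o⟩ : Walk n).toStore P α β, some .head) := by
    intro σ' hr hcur hlev hwid hmode hbit hold htup hout
    have hone : σ'.reg .one = 1 := hr .one (by simp) (by simp) (by simp) (by simp) (by simp)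
      (by simp) (by simp) (by simp)
    have hdep : ∀ i s', σ'.reg (.dep i s') = origin P α β (child p s) i s' := fun i s' =>
      hr _ (by simp) (by simp) (by simp) (by simp) (by simp) (by simp) (by simp) (by simp)
    have hside : (Code.ifLe .one .bit (eraseCode (dir k p) .lower)
        (eraseCode (dir k p) .upper)).exec .cur P α β σ' =
        (eraseCode (dir k p) s).exec .cur P α β σ' := by
      rw [exec_ifLe, hone, hbit]
      cases s <;> simp [Side.bit]
    rw [hside, exec_erase, exec_back, hold, hdep]
    have horg := origin_child_cases (α := α) (β := β) hp (by omega : p ≤ n) hP hgp s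
    refine Prod.ext (Store.ext_iff'.2 ⟨fun r => ?_, fun i s' => ?_, ?_⟩) rfl
    · cases r with
      | dep i s' =>
        simp only [Store.set_reg, reduceCtorEq, if_false, Walk.toStore]
        rw [horg]
        split_ifs with h1 h2 h2
        · obtain ⟨rfl, rfl, -⟩ := h2
          simp [Store.setEntry_reg, Store.set_reg]
        · rw [Store.setEntry_reg, Store.set_reg, if_neg, hdep]
          intro h
          cases h
          exact h2 ⟨rfl, rfl, h1⟩
        · obtain ⟨rfl, rfl, h3⟩ := h2
          exact absurd h3 h1
        · exact hdep i s'
      | _ =>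
        split_ifs <;>
          simp [Store.set_reg, Store.setEntry_reg, Walk.toStore, hcur, hlev, hwid, hmode, hr, hσ]
    · have htup' : σ'.tuple i s' = entryAt P α β (child p s) i s' := by
        rw [htup]
        rfl
      simp only [Store.set_tuple, Walk.toStore]
      by_cases h2 : i = dir k p ∧ s' = s
      · obtain ⟨rfl, rfl⟩ := h2
        by_cases h1 : child p s' ≤ origin P α β (child p s') (dir k p) s'
        · have ho : origin P α β p (dir k p) s' = 0 := by rw [horg, if_pos ⟨rfl, rfl, h1⟩]
          rw [if_pos h1, Store.setEntry_tuple, if_pos ⟨rfl, rfl⟩, entryAt, if_pos ho]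
        · have ho : origin P α β p (dir k p) s' = origin P α β (child p s') (dir k p) s' := by
            rw [horg, if_neg fun h => h1 h.2.2]
          rw [if_neg h1, htup', entryAt, entryAt, ho]
      · have ho : origin P α β p i s' = origin P α β (child p s) i s' := by
          rw [horg, if_neg fun h => h2 ⟨h.1, h.2.1⟩]
        have he : σ'.tuple i s' = entryAt P α β p i s' := by
          rw [htup', entryAt, entryAt, ho]
        split_ifs
        · rw [Store.setEntry_tuple, if_neg h2]
          exact he
        · exact he
    · have : σ'.output = o := hout
      split_ifs <;> simp [Store.set_output, Store.setEntry_output, Walk.toStore, this]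
  rw [hmod, ascendCode, exec_ifLe, if_neg (by simp [hσ, Walk.toStore]; omega), exec_arith,
    exec_arith, exec_arith, exec_arith, exec_arith, exec_arith, exec_arith,
    exec_split (t := p) _ _ (by simp [Store.set_reg, hσ, Walk.toStore])
      (by simp [Store.set_reg, hσ, Walk.toStore, WordOp.eval, log_child hp])]
  refine hfin _ (fun r h1 h2 h3 h4 h5 h6 h7 h8 => ?_) ?_ ?_ ?_ ?_ ?_ ?_ rfl rfl
  · simp only [Store.set_reg, h1, h2, h3, h4, h5, h6, h7, h8, if_false]
  all_goals simp [Store.set_reg, hσ, Walk.toStore, WordOp.eval, log_child hp, child_div, hbit, hwid]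

theorem exec_head (hP : IsKDTree P) {w : Walk n} (hw : w.Valid P α β)
    (hfin : ¬ (w.mode = 3 ∧ w.node = 1)) :
    (headCode prune).exec .cur P α β (w.toStore P α β) =
      ((w.next prune P α β).toStore P α β, some .head) := by
  have hmode := hw.2.2
  have h0 : (w.toStore P α β).reg .mode = w.mode := rfl
  have h1 : (w.toStore P α β).reg .tmp = 0 := rfl
  have h2 : (w.toStore P α β).reg .one = 1 := rfl
  have h3 : (w.toStore P α β).reg .two = 2 := rfl
  rw [headCode, exec_ifLe, exec_ifLe, exec_ifLe, h0, h1, h2, h3]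
  obtain ⟨t, mode, c, o⟩ := w
  simp only at hmode hfin ⊢
  rcases (by omega : mode = 0 ∨ mode = 1 ∨ mode = 2 ∨ mode = 3) with rfl | rfl | rfl | rfl
  · exact exec_process hw hP rfl
  · exact exec_child hP hw .upper
  · exact exec_child hP hw .lower
  · refine exec_ascend hP hw ?_
    have := hw.1.1
    simp only at this ⊢
    omega

end Simulation

/-! ### The number of visited nodes -/

/-- The bound for the number of nodes whose cells cross a facet. -/
def crossBound (k n : ℕ) : ℕ := ∑ l ∈ Finset.range (Nat.log 2 n + 1), 2 ^ (l - l / k)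

theorem log_lt_crossBound (k n : ℕ) : Nat.log 2 n + 1 ≤ crossBound k n := by
  have := Finset.card_nsmul_le_sum (Finset.range (Nat.log 2 n + 1)) (fun l => 2 ^ (l - l / k)) 1
    fun l _ => Nat.one_le_two_pow
  simpa [crossBound] using this

section

variable {k n : ℕ} {P : Fin n → Fin k → ℝ} {α β : Fin k → ℝ}

/-- The cell of `v` contains points on both sides of the hyperplane through the facet `(i, s)` of the
query range; the side that contains the query range is closed, the other one is open. -/
def Crosses (P : Fin n → Fin k → ℝ) (α β : Fin k → ℝ) (i : Fin k) (s : Side) (v : ℕ) : Prop :=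
  (∀ c, cellBound P v i s = some c → ¬ s.le (endpoint α β s i) c) ∧
    ∀ c, cellBound P v i s.opp = some c → s.le (endpoint α β s i) c

/-- Take a facet that is not in the query interval. As the cell meets the query range, that bound is
absent or strictly outside the range, while the opposite bound is not beyond the query endpoint; so
the cell extends across it. -/
theorem exists_crosses {v : ℕ} (hg : Good P α β v) (h : ¬ ∀ i s, InBand P α β v i s) :
    ∃ i s, Crosses P α β i s v := by
  push Not at h
  obtain ⟨i, s, h⟩ := h
  refine ⟨i, s, fun c hc hle => h ⟨c, hc, hle, hg i s c hc⟩, fun c hc => ?_⟩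
  have := hg i s.opp c hc
  rwa [Side.opp_opp, Side.opp_le] at this

theorem card_le_of_half {A B : Finset ℕ} {m : ℕ} (hAB : ∀ v ∈ A, v / 2 ∈ B)
    (hm : ∀ u ∈ B, ({v ∈ A | v / 2 = u} : Finset ℕ).card ≤ m) : A.card ≤ m * B.card :=
  Finset.card_le_mul_card_image_of_maps_to hAB m hm

theorem filter_half_subset (A : Finset ℕ) (u : ℕ) :
    ({v ∈ A | v / 2 = u} : Finset ℕ) ⊆ {child u .upper, child u .lower} := by
  intro v hv
  have := (Finset.mem_filter.1 hv).2
  simp only [Finset.mem_insert, Finset.mem_singleton, child, Side.bit]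
  omega

theorem card_filter_half_le (A : Finset ℕ) (u : ℕ) :
    ({v ∈ A | v / 2 = u} : Finset ℕ).card ≤ 2 :=
  (Finset.card_le_card (filter_half_subset A u)).trans Finset.card_le_two

/-- Every block of `k` consecutive levels splits once in direction `i`. -/
theorem div_le_count (hk : 0 < k) (i : Fin k) (l : ℕ) :
    l / k ≤ Nat.count (fun j => j % k = i) l := by
  have h := Nat.count_modEq_card l hk (i : ℕ)
  simp only [Nat.ModEq, Nat.mod_eq_of_lt i.2] at h
  rw [h]
  exact Nat.le_add_right _ _

variable [NeZero k]

theorem Crosses.of_child (hP : IsKDTree P) {u : ℕ} (h1 : 1 ≤ u) (h2 : u ≤ n) {i : Fin k}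
    {s s' : Side} (h : Crosses P α β i s (child u s')) : Crosses P α β i s u := by
  by_cases hi : i = dir k u
  · subst hi
    rcases Side.eq_or_eq_opp s s' with rfl | rfl
    · refine ⟨fun c hc hle => ?_, fun c hc => h.2 c ?_⟩
      · exact h.1 _ (cellBound_child_self P h1 h2 s')
          (Side.le_trans hle (hP.bound_le_self h1 h2 hc))
      · rw [cellBound_child_of_ne P h1 fun h => Side.opp_ne _ h.2, hc]
    · refine ⟨fun c hc => h.1 c ?_, fun c hc => ?_⟩
      · rw [cellBound_child_of_ne P h1 fun h => Side.opp_ne _ h.2.symm, hc]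
      · exact Side.le_trans (h.2 _ (cellBound_child_self P h1 h2 _))
          (Side.opp_le.1 (hP.bound_le_self h1 h2 hc))
  · have hne : ∀ s'', ¬ (i = dir k u ∧ s'' = s') := fun s'' h => hi h.1
    exact ⟨fun c hc => h.1 c (by rw [cellBound_child_of_ne P h1 (hne _), hc]),
      fun c hc => h.2 c (by rw [cellBound_child_of_ne P h1 (hne _), hc])⟩

/-- The two children compare the same split value with the same endpoint, in opposite ways. Having
one strict and one weak condition in `Crosses` makes them exclusive even if the two values are
equal. -/
theorem not_crosses_both {u : ℕ} (h1 : 1 ≤ u) (h2 : u ≤ n) {s : Side}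
    (h : Crosses P α β (dir k u) s (child u s)) :
    ¬ Crosses P α β (dir k u) s (child u s.opp) :=
  fun h' => h.1 _ (cellBound_child_self P h1 h2 s) (h'.2 _ (cellBound_child_self P h1 h2 s.opp))

open Classical in
/-- On level `l`, the number of cells that cross a facet is at most doubled from level to level, and
not increased at the levels that split in the direction of the facet. -/
theorem card_crosses_level (hP : IsKDTree P) (i : Fin k) (s : Side) (l : ℕ) :
    ({v ∈ Finset.Icc 1 n | Nat.log 2 v = l ∧ Crosses P α β i s v} : Finset ℕ).card ≤
      2 ^ (l - Nat.count (fun j => j % k = i) l) := by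
  induction l with
  | zero =>
    refine (Finset.card_le_card (t := {1}) fun v hv => ?_).trans (by simp)
    simp only [Finset.mem_filter, Finset.mem_Icc] at hv
    have := (Nat.log_eq_zero_iff.1 hv.2.1).resolve_right (by norm_num)
    simp only [Finset.mem_singleton]
    omega
  | succ l ih =>
    have hmem : ∀ v ∈ ({v ∈ Finset.Icc 1 n | Nat.log 2 v = l + 1 ∧ Crosses P α β i s v} :
        Finset ℕ), v / 2 ∈
        ({v ∈ Finset.Icc 1 n | Nat.log 2 v = l ∧ Crosses P α β i s v} : Finset ℕ) := by
      intro v hv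
      simp only [Finset.mem_filter, Finset.mem_Icc] at hv ⊢
      obtain ⟨⟨hv1, hv2⟩, hv3, hv4⟩ := hv
      have : 2 ≤ v := by
        by_contra hcon
        obtain rfl : v = 1 := by omega
        simp at hv3
      obtain ⟨u, s', hu, rfl⟩ := exists_eq_child this
      have := lt_child hu s'
      rw [log_child hu] at hv3
      rw [child_div]
      exact ⟨⟨hu, by omega⟩, by omega, hv4.of_child hP hu (by omega)⟩
    have hle : Nat.count (fun j => j % k = i) l ≤ l := Nat.count_le _
    rw [Nat.count_succ]
    by_cases hl : l % k = i
    · rw [if_pos hl, Nat.add_sub_add_right]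
      refine (card_le_of_half (m := 1) hmem fun u hu => ?_).trans (by omega)
      simp only [Finset.mem_filter, Finset.mem_Icc] at hu
      obtain ⟨⟨hu1, hu2⟩, hu3, -⟩ := hu
      have hdir : i = dir k u := by
        rw [← hu3] at hl
        exact Fin.ext hl.symm
      subst hdir
      rw [Finset.card_le_one]
      have key : ∀ v ∈ ({v ∈ ({v ∈ Finset.Icc 1 n | Nat.log 2 v = l + 1 ∧
          Crosses P α β (dir k u) s v} : Finset ℕ) | v / 2 = u} : Finset ℕ),
          ∃ s', v = child u s' ∧ Crosses P α β (dir k u) s (child u s') := by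
        intro v hv
        have hv' := filter_half_subset _ u hv
        simp only [Finset.mem_filter, Finset.mem_insert, Finset.mem_singleton] at hv hv'
        rcases hv' with rfl | rfl
        · exact ⟨_, rfl, hv.1.2.2⟩
        · exact ⟨_, rfl, hv.1.2.2⟩
      intro v hv v' hv'
      obtain ⟨t, rfl, ht⟩ := key v hv
      obtain ⟨t', rfl, ht'⟩ := key v' hv'
      rcases Side.eq_or_eq_opp s t with h' | h' <;> rcases Side.eq_or_eq_opp s t' with h | h <;>
        rw [h'] at ht ⊢
      · rw [h]
      · rw [h] at ht'
        exact absurd ht' (not_crosses_both hu1 hu2 ht)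
      · rw [h] at ht'
        exact absurd ht (not_crosses_both hu1 hu2 ht')
      · rw [h]
    · rw [if_neg hl, add_zero, Nat.sub_add_comm hle, pow_succ']
      exact (card_le_of_half (m := 2) hmem fun u _ => card_filter_half_le _ u).trans
        (Nat.mul_le_mul_left 2 ih)

open Classical in
theorem card_crosses (hP : IsKDTree P) (i : Fin k) (s : Side) :
    ({v ∈ Finset.Icc 1 n | Crosses P α β i s v} : Finset ℕ).card ≤ crossBound k n := by
  have hsub : ({v ∈ Finset.Icc 1 n | Crosses P α β i s v} : Finset ℕ) ⊆
      (Finset.range (Nat.log 2 n + 1)).biUnion fun l =>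
        {v ∈ Finset.Icc 1 n | Nat.log 2 v = l ∧ Crosses P α β i s v} := by
    intro v hv
    simp only [Finset.mem_biUnion, Finset.mem_filter, Finset.mem_range, Finset.mem_Icc] at hv ⊢
    have := Nat.log_mono_right (b := 2) hv.1.2
    exact ⟨Nat.log 2 v, by omega, hv.1, rfl, hv.2⟩
  refine (Finset.card_le_card hsub).trans (Finset.card_biUnion_le.trans ?_)
  refine Finset.sum_le_sum fun l _ => (card_crosses_level hP i s l).trans ?_
  have := div_le_count (Nat.pos_of_ne_zero (NeZero.ne k)) i l
  exact Nat.pow_le_pow_right (by norm_num) (by omega)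

open Classical in
theorem card_exists_crosses (hP : IsKDTree P) :
    ({v ∈ Finset.Icc 1 n | ∃ i s, Crosses P α β i s v} : Finset ℕ).card ≤
      2 * k * crossBound k n := by
  have hsub : ({v ∈ Finset.Icc 1 n | ∃ i s, Crosses P α β i s v} : Finset ℕ) ⊆
      (Finset.univ : Finset (Fin k)).biUnion fun i =>
        {v ∈ Finset.Icc 1 n | Crosses P α β i .lower v} ∪
        {v ∈ Finset.Icc 1 n | Crosses P α β i .upper v} := by
    intro v hv
    simp only [Finset.mem_biUnion, Finset.mem_filter, Finset.mem_union, Finset.mem_univ,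
      true_and] at hv ⊢
    obtain ⟨hv, i, s, h⟩ := hv
    cases s
    · exact ⟨i, Or.inl ⟨hv, h⟩⟩
    · exact ⟨i, Or.inr ⟨hv, h⟩⟩
  refine (Finset.card_le_card hsub).trans (Finset.card_biUnion_le.trans ?_)
  refine (Finset.sum_le_card_nsmul _ _ (2 * crossBound k n) fun i _ =>
    (Finset.card_union_le _ _).trans ?_).trans (by simp [mul_comm, mul_left_comm])
  have h1 := card_crosses (α := α) (β := β) hP i .lower
  have h2 := card_crosses (α := α) (β := β) hP i .upper
  omega

/-- The number of nodes visited by the reporting program. -/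
theorem sum_visited_report (hP : IsKDTree P) :
    ∑ v ∈ Finset.Icc 1 n, visited false P α β v ≤
      ∑ v ∈ Finset.Icc 1 n, hit P α β v + 2 * k * crossBound k n := by
  classical
  refine le_trans ?_ (Nat.add_le_add_left (card_exists_crosses (α := α) (β := β) hP) _)
  rw [Finset.card_filter, ← Finset.sum_add_distrib]
  refine Finset.sum_le_sum fun v hv => ?_
  rw [Finset.mem_Icc] at hv
  rw [visited, hit]
  by_cases hg : Good P α β v
  · by_cases hb : ∀ i s, InBand P α β v i s
    · rw [if_pos (hP.inRange_of_inBand (m := 0) hv.1 hv.1 hv.2 (by simp) hb)]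
      split_ifs <;> omega
    · rw [if_pos (exists_crosses hg hb)]
      split_ifs <;> omega
  · rw [if_neg fun h => hg h.1]
    omega

/-- The number of nodes visited by the counting program. -/
theorem sum_visited_count (hP : IsKDTree P) :
    ∑ v ∈ Finset.Icc 1 n, visited true P α β v ≤ 1 + 4 * k * crossBound k n := by
  classical
  have hB := card_exists_crosses (α := α) (β := β) hP
  set B := ({v ∈ Finset.Icc 1 n | ∃ i s, Crosses P α β i s v} : Finset ℕ) with hBdef
  have hA : ({v ∈ Finset.Icc 1 n | v / 2 ∈ B} : Finset ℕ).card ≤ 2 * B.card :=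
    card_le_of_half (fun v hv => (Finset.mem_filter.1 hv).2) fun u _ => card_filter_half_le _ u
  -- A visited node other than the root has a parent that was not pruned, so some facet of the
  -- parent misses the query range and the parent crosses.
  have hsub : ({v ∈ Finset.Icc 1 n | Good P α β v ∧ (v ≤ 1 ∨ ¬ Pruned true P α β (v / 2))} :
      Finset ℕ) ⊆ insert 1 {v ∈ Finset.Icc 1 n | v / 2 ∈ B} := by
    intro v hv
    simp only [Finset.mem_filter, Finset.mem_insert, Finset.mem_Icc, hBdef] at hv ⊢
    obtain ⟨⟨hv1, hv2⟩, hg, hv3⟩ := hv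
    refine or_iff_not_imp_left.2 fun hne => ?_
    have hpr := hv3.resolve_left (by omega)
    obtain ⟨u, s, hu, rfl⟩ := exists_eq_child (t := v) (by omega)
    have hlt := lt_child hu s
    rw [child_div] at hpr ⊢
    have hgu := hg.of_child hP hu (by omega)
    refine ⟨⟨hv1, hv2⟩, ⟨hu, by omega⟩, exists_crosses hgu fun hb => hpr ⟨rfl, fun i s => ?_⟩⟩
    exact (origin_ne_zero_iff hP (by omega) hgu i s).2 (hb i s)
  have hcard := (Finset.card_le_card hsub).trans (Finset.card_insert_le _ _)
  simp only [visited]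
  rw [← Finset.card_filter]
  have : 4 * k * crossBound k n = 2 * (2 * k * crossBound k n) := by ring
  omega

end

/-- The geometric sum in the bound for the number of crossing cells. -/
theorem exists_crossBound_le (k : ℕ) (hk : 2 ≤ k) : ∃ A : ℕ, ∀ n, 1 ≤ n →
    (crossBound k n : ℝ) ≤ A * (n : ℝ) ^ (1 - 1 / (k : ℝ)) := by
  have hk0 : (0 : ℝ) < k := by positivity
  have hk1 : (1 : ℝ) < k := by exact_mod_cast hk
  set e : ℝ := 1 - 1 / (k : ℝ) with he
  have he0 : 0 < e := by
    rw [he, sub_pos, div_lt_one hk0]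
    exact hk1
  set q : ℝ := 2 ^ e with hq
  have hq1 : 1 < q := Real.one_lt_rpow (by norm_num) he0
  refine ⟨⌈2 * (q / (q - 1))⌉₊, fun n hn => ?_⟩
  -- Rounding `l / k` down raises the exponent `e * l` by at most one, which costs the factor `2`.
  have hterm : ∀ l : ℕ, ((2 ^ (l - l / k) : ℕ) : ℝ) ≤ 2 * q ^ l := by
    intro l
    have h1 : ((2 ^ (l - l / k) : ℕ) : ℝ) = (2 : ℝ) ^ ((l : ℝ) - (l / k : ℕ)) := by
      rw [← Nat.cast_sub (Nat.div_le_self l k), Real.rpow_natCast]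
      push_cast
      rfl
    have h2 : 2 * q ^ l = (2 : ℝ) ^ (1 + e * l) := by
      rw [Real.rpow_add (by norm_num), Real.rpow_one, Real.rpow_mul (by norm_num),
        Real.rpow_natCast]
    rw [h1, h2]
    refine Real.rpow_le_rpow_of_exponent_le (by norm_num) ?_
    have h3 : (l : ℝ) < k * ((l / k : ℕ) + 1) := by
      have := Nat.lt_mul_div_succ l (by omega : 0 < k)
      exact_mod_cast this
    have h4 : (l : ℝ) / k ≤ (l / k : ℕ) + 1 := by
      rw [div_le_iff₀ hk0]
      linarith
    have h5 : e * l = l - l / k := by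
      rw [he]
      ring
    rw [h5]
    linarith
  have hgeom : ∑ l ∈ Finset.range (Nat.log 2 n + 1), q ^ l ≤
      q / (q - 1) * q ^ Nat.log 2 n := by
    rw [geom_sum_eq hq1.ne', div_mul_eq_mul_div, pow_succ']
    have : 0 < q - 1 := by linarith
    gcongr
    linarith
  have hpow : q ^ Nat.log 2 n ≤ (n : ℝ) ^ e := by
    rw [hq, ← Real.rpow_natCast, ← Real.rpow_mul (by norm_num), mul_comm,
      Real.rpow_mul (by norm_num), Real.rpow_natCast]
    refine Real.rpow_le_rpow (by positivity) ?_ he0.le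
    exact_mod_cast Nat.pow_log_le_self 2 (by omega)
  have hc : 0 ≤ 2 * (q / (q - 1)) := by
    have : 0 < q - 1 := by linarith
    positivity
  calc (crossBound k n : ℝ) = ∑ l ∈ Finset.range (Nat.log 2 n + 1), ((2 ^ (l - l / k) : ℕ) : ℝ) := by
        rw [crossBound, Nat.cast_sum]
    _ ≤ ∑ l ∈ Finset.range (Nat.log 2 n + 1), 2 * q ^ l := Finset.sum_le_sum fun l _ => hterm l
    _ = 2 * ∑ l ∈ Finset.range (Nat.log 2 n + 1), q ^ l := (Finset.mul_sum _ _ _).symm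
    _ ≤ 2 * (q / (q - 1) * q ^ Nat.log 2 n) := by gcongr
    _ = 2 * (q / (q - 1)) * q ^ Nat.log 2 n := by ring
    _ ≤ ⌈2 * (q / (q - 1))⌉₊ * (n : ℝ) ^ e := by
        gcongr
        exact Nat.le_ceil _

/-! ### The range count -/

section

variable {k n : ℕ} {P : Fin n → Fin k → ℝ} {α β : Fin k → ℝ}

theorem inRange_iff (j : Fin n) : InRange P α β (j + 1) ↔ P j ∈ Set.Icc α β := by
  simp only [InRange, pt_eq, Set.mem_Icc, Pi.le_def, forall_and]

theorem sum_Icc_eq_sum_fin (f : ℕ → ℕ) : ∑ v ∈ Finset.Icc 1 n, f v = ∑ j : Fin n, f (j + 1) := by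
  rw [← Finset.sum_range (fun j => f (j + 1)), Finset.range_eq_Ico,
    Finset.sum_Ico_add' f 0 n 1]
  rfl

theorem sum_hit : ∑ v ∈ Finset.Icc 1 n, hit P α β v = rangeCount P α β := by
  classical
  rw [sum_Icc_eq_sum_fin, rangeCount, Nat.card_eq_fintype_card, Fintype.card_subtype,
    Finset.card_filter]
  exact Finset.sum_congr rfl fun j _ => if_congr (inRange_iff j) rfl rfl

theorem rangeCount_le : rangeCount P α β ≤ n := by
  rw [rangeCount]
  exact (Finite.card_subtype_le _).trans (by simp)

/-! ### The complete walk -/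

variable [NeZero k] {prune : Bool}

/-- The walk from the root reaches the final state for the first time after `N` rounds. -/
theorem exists_walk (prune : Bool) (hn : 1 ≤ n) (hP : IsKDTree P) : ∃ N,
    N ≤ 5 * ∑ v ∈ Finset.Icc 1 n, visited prune P α β v ∧
    (∀ m < N, ¬ (((Walk.next prune P α β)^[m] (Walk.start n)).mode = 3 ∧
      ((Walk.next prune P α β)^[m] (Walk.start n)).node = 1)) ∧
    ((Walk.next prune P α β)^[N] (Walk.start n)).mode = 3 ∧
    ((Walk.next prune P α β)^[N] (Walk.start n)).node = 1 ∧
    ((Walk.next prune P α β)^[N] (Walk.start n)).count = rangeCount P α β ∧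
    (prune = false → ((Walk.next prune P α β)^[N] (Walk.start n)).output.Nodup ∧
      ∀ j : Fin n, j ∈ ((Walk.next prune P α β)^[N] (Walk.start n)).output ↔
        P j ∈ Set.Icc α β) := by
  classical
  obtain ⟨N', c, o, hN, hle, hc, ho⟩ := Walk.traverse (prune := prune) (α := α) (β := β) hP le_rfl
    hn (good_root le_rfl) (Or.inl le_rfl) 0 []
  rw [subtree_root] at hle hc ho
  have hex : ∃ m, ((Walk.next prune P α β)^[m] (Walk.start n)).mode = 3 ∧
      ((Walk.next prune P α β)^[m] (Walk.start n)).node = 1 := ⟨N', by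
    change ((Walk.next prune P α β)^[N'] ⟨1, 0, 0, []⟩).mode = 3 ∧
      ((Walk.next prune P α β)^[N'] ⟨1, 0, 0, []⟩).node = 1
    rw [hN]
    exact ⟨rfl, rfl⟩⟩
  have hmin : Nat.find hex ≤ N' := Nat.find_min' hex (by
    change ((Walk.next prune P α β)^[N'] ⟨1, 0, 0, []⟩).mode = 3 ∧
      ((Walk.next prune P α β)^[N'] ⟨1, 0, 0, []⟩).node = 1
    rw [hN]
    exact ⟨rfl, rfl⟩)
  obtain ⟨h3, h1⟩ := Nat.find_spec hex
  -- The machine halts at the first final state. Final states are fixed by `next`, so this one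
  -- agrees with the state found by the traversal.
  have hstay : ∀ w : Walk n, w.mode = 3 → w.node = 1 → w.next prune P α β = w := by
    rintro ⟨t, mode, c, o⟩ rfl rfl
    rfl
  have heq : (Walk.next prune P α β)^[Nat.find hex] (Walk.start n) = ⟨1, 3, c, o⟩ := by
    rw [← hN]
    obtain ⟨e, rfl⟩ := Nat.exists_eq_add_of_le' hmin
    rw [Function.iterate_add_apply]
    exact (Function.iterate_fixed (hstay _ h3 h1) e).symm
  refine ⟨Nat.find hex, hmin.trans hle, fun m hm => Nat.find_min hex hm, h3, h1, ?_, ?_⟩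
  · rw [heq, ← sum_hit, hc, zero_add]
  · intro hprune
    have hcount : ∀ j, o.count j = if P j ∈ Set.Icc α β then 1 else 0 := by
      intro j
      rw [ho hprune j, Finset.sum_ite_eq', if_pos, List.count_nil, zero_add, hit]
      · exact if_congr (inRange_iff j) rfl rfl
      · have := j.2
        rw [Finset.mem_Icc]
        omega
    rw [heq]
    refine ⟨List.nodup_iff_count_le_one.2 fun j => ?_, fun j => ?_⟩
    · rw [hcount]
      split_ifs <;> omega
    · rw [← List.count_pos_iff, hcount]
      split_ifs with h <;> simp [h]

theorem node_next (w : Walk n) : (w.next prune P α β).node = w.node ∨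
    (w.next prune P α β).node = 2 * w.node ∨ (w.next prune P α β).node = 2 * w.node + 1 ∨
    (w.next prune P α β).node = w.node / 2 := by
  rw [Walk.next]
  split
  · rw [Walk.process]
    split_ifs <;> exact Or.inl rfl
  · rw [Walk.tryChild]
    split_ifs
    · exact Or.inr (Or.inl rfl)
    · exact Or.inl rfl
  · rw [Walk.tryChild]
    split_ifs
    · exact Or.inr (Or.inr (Or.inl rfl))
    · exact Or.inl rfl
  · rw [Walk.ascend]
    split_ifs
    · exact Or.inl rfl
    · exact Or.inr (Or.inr (Or.inr rfl))

/-- The stores that occur at the starts of the loops of a walk of `N` rounds. -/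
def LoopInv (prune : Bool) (P : Fin n → Fin k → ℝ) (α β : Fin k → ℝ) (N : ℕ) :
    Loop → Store k n (Reg k) → Prop
  | .start, σ => σ = ⟨fun _ => 0, fun _ _ => none, []⟩
  | .init, σ => ∃ j ≤ Nat.log 2 n, σ = initStore k n j
  | .head, σ => ∃ m ≤ N, σ = ((Walk.next prune P α β)^[m] (Walk.start n)).toStore P α β

variable {N : ℕ}

theorem LoopInv.step (hn : 1 ≤ n) (hP : IsKDTree P)
    (h3 : ((Walk.next prune P α β)^[N] (Walk.start n)).mode = 3)
    (h1 : ((Walk.next prune P α β)^[N] (Walk.start n)).node = 1) (l : Loop)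
    (σ : Store k n (Reg k)) (hσ : LoopInv prune P α β N l σ) (l' : Loop)
    (hl' : (((treeProgram k prune).body l).exec .cur P α β σ).2 = some l') :
    LoopInv prune P α β N l' (((treeProgram k prune).body l).exec .cur P α β σ).1 := by
  cases l with
  | start =>
    cases hσ
    simp only [treeProgram, exec_startCode, Option.some.injEq] at hl' ⊢
    subst hl'
    exact ⟨0, Nat.zero_le _, rfl⟩
  | init =>
    obtain ⟨j, hj, rfl⟩ := hσ
    rcases hj.lt_or_eq with hj | rfl
    · have hle : 2 ^ (j + 1) ≤ n := Nat.pow_le_of_le_log (by omega) hj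
      simp only [treeProgram, exec_initCode_of_le hle, Option.some.injEq] at hl' ⊢
      subst hl'
      exact ⟨j + 1, hj, rfl⟩
    · simp only [treeProgram, exec_initCode_log, Option.some.injEq] at hl' ⊢
      subst hl'
      exact ⟨0, Nat.zero_le _, rfl⟩
  | head =>
    obtain ⟨m, hm, rfl⟩ := hσ
    by_cases hfin : ((Walk.next prune P α β)^[m] (Walk.start n)).mode = 3 ∧
        ((Walk.next prune P α β)^[m] (Walk.start n)).node = 1
    · simp only [treeProgram, exec_head_final hfin.1 hfin.2] at hl'
      cases hl'
    · simp only [treeProgram, exec_head hP (Walk.valid_iterate hP hn m) hfin,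
        Option.some.injEq] at hl' ⊢
      subst hl'
      have hne : m ≠ N := by
        rintro rfl
        exact hfin ⟨h3, h1⟩
      exact ⟨m + 1, by omega, by rw [Function.iterate_succ_apply']⟩

/-- One bound for node numbers, widths and counts, which are at most `n`, and for the constants and
modes, which are at most `k + 4`. As a product it splits into a logarithmic and a constant number of
bits. -/
theorem LoopInv.reg_le (hn : 1 ≤ n) (hP : IsKDTree P)
    (hcount : ((Walk.next prune P α β)^[N] (Walk.start n)).count = rangeCount P α β) (l : Loop)
    (σ : Store k n (Reg k)) (hσ : LoopInv prune P α β N l σ) (r : Reg k) :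
    σ.reg r ≤ n * (k + 4) := by
  have hnk : n ≤ n * (k + 4) := Nat.le_mul_of_pos_right _ (by omega)
  have hkn : k + 4 ≤ n * (k + 4) := Nat.le_mul_of_pos_left _ hn
  have hpow : ∀ j ≤ Nat.log 2 n, 2 ^ j ≤ n * (k + 4) := fun j hj =>
    (Nat.pow_le_of_le_log (by omega) hj).trans hnk
  cases l with
  | start =>
    cases hσ
    exact Nat.zero_le _
  | init =>
    obtain ⟨j, hj, rfl⟩ := hσ
    have := hpow j hj
    cases r <;> simp only [initStore] <;> omega
  | head =>
    obtain ⟨m, hm, rfl⟩ := hσ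
    have hv := Walk.valid_iterate (prune := prune) (α := α) (β := β) hP hn m
    have hc := Walk.count_mono (prune := prune) (P := P) (α := α) (β := β) (Walk.start n) hm
    simp only [hcount] at hc
    have hc' := rangeCount_le (P := P) (α := α) (β := β)
    generalize (Walk.next prune P α β)^[m] (Walk.start n) = w at hv hc
    obtain ⟨⟨-, h2⟩, -, h4⟩ := hv
    have hlog := Nat.log_le_self 2 w.node
    have hwid := hpow (Nat.log 2 n - Nat.log 2 w.node) (Nat.sub_le _ _)
    cases r with
    | dep i s => exact (origin_le _ i s).trans (h2.trans hnk)
    | _ => simp only [Walk.toStore]; omega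

end

/-! ### The complete run -/

section

variable {k n : ℕ} {P : Fin n → Fin k → ℝ} {α β : Fin k → ℝ} {prune : Bool} {N H : ℕ}

theorem Program.SmallWords.mono {M : Program k} {C C' : ℕ}
    (h : M.SmallWords P α β C) (hC : C ≤ C') : M.SmallWords P α β C' :=
  fun T r => (h T r).trans (Nat.mul_le_mul_right _ hC)

theorem Program.TracksTuple.mono {M : Program k} {C C' : ℕ}
    (h : M.TracksTuple P α β C) (hC : C ≤ C') : M.TracksTuple P α β C' := by
  obtain ⟨⟨T, hT, h1⟩, h2⟩ := h
  refine ⟨⟨T, hT.trans (Nat.mul_le_mul_right _ hC), h1⟩, fun T hT => ?_⟩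
  obtain ⟨h3, h4, d, hd1, hd, h5⟩ := h2 T hT
  exact ⟨h3, h4, d, hd1, hd.trans hC, h5⟩

theorem exists_height (k : ℕ) (prune : Bool) :
    ∃ H, ∀ l, ((treeProgram k prune).body l).height ≤ H := by
  have : Finite (treeProgram k prune).L := finite_loop
  obtain ⟨H, hH⟩ := (Set.finite_range fun l => ((treeProgram k prune).body l).height).bddAbove
  exact ⟨H, fun l => hH ⟨l, rfl⟩⟩

/-- The initialization takes logarithmic time. -/
theorem run_init (hH : ∀ l, ((treeProgram k prune).body l).height ≤ H) (hn : 1 ≤ n) :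
    ∃ T ≤ H * (Nat.log 2 n + 2), (treeProgram k prune).toProgram.run P α β T =
      (treeProgram k prune).conf ((treeProgram k prune).entry .head)
        ((Walk.start n).toStore P α β) := by
  obtain ⟨d, -, hd, -, hsome, -⟩ := (treeProgram k prune).run_body P α β .start
    (⟨fun _ => 0, fun _ _ => none, []⟩ : Store k n (Reg k))
  have e : ((treeProgram k prune).body .start).exec .cur P α β
    (⟨fun _ => 0, fun _ _ => none, []⟩ : Store k n (Reg k)) = _ := exec_startCode
  have hs := hsome .init (congrArg Prod.snd e)
  obtain ⟨T, hT, hrun⟩ := (treeProgram k prune).run_iterate P α β hH .init (Nat.log 2 n)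
    (initStore k n) fun m hm => exec_initCode_of_le (Nat.pow_le_of_le_log (by omega) hm)
  obtain ⟨d', -, hd', -, hsome', -⟩ := (treeProgram k prune).run_body P α β .init
    (initStore k n (Nat.log 2 n))
  have e' : ((treeProgram k prune).body .init).exec .cur P α β
    (initStore k n (Nat.log 2 n)) = _ := exec_initCode_log
  have hs' := hsome' .head (congrArg Prod.snd e')
  have h1 := hd.trans (hH _)
  have h2 := hd'.trans (hH _)
  refine ⟨d' + (T + d), ?_, ?_⟩
  · rw [Nat.mul_add]
    omega
  · rw [Program.run, Function.iterate_add_apply, Function.iterate_add_apply]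
    refine Eq.trans (congrArg _ (congrArg _ hs)) ?_
    rw [show ((treeProgram k prune).body .start).exec (treeProgram k prune).cur P α β
      (⟨fun _ => 0, fun _ _ => none, []⟩ : Store k n (Reg k)) = _ from e]
    refine Eq.trans (congrArg _ hrun) (hs'.trans ?_)
    exact congrArg _ (congrArg Prod.fst e')

variable [NeZero k]

/-- The walk ends in a halted configuration. -/
theorem run_walk (hH : ∀ l, ((treeProgram k prune).body l).height ≤ H) (hn : 1 ≤ n)
    (hP : IsKDTree P)
    (hlt : ∀ m < N, ¬ (((Walk.next prune P α β)^[m] (Walk.start n)).mode = 3 ∧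
      ((Walk.next prune P α β)^[m] (Walk.start n)).node = 1))
    (h3 : ((Walk.next prune P α β)^[N] (Walk.start n)).mode = 3)
    (h1 : ((Walk.next prune P α β)^[N] (Walk.start n)).node = 1) :
    ∃ T ≤ H * (Nat.log 2 n + 3 + N), ((treeProgram k prune).toProgram.run P α β T).Halted ∧
      ((treeProgram k prune).toProgram.run P α β T).reg Reg.out =
        ((Walk.next prune P α β)^[N] (Walk.start n)).count ∧
      ((treeProgram k prune).toProgram.run P α β T).output =
        ((Walk.next prune P α β)^[N] (Walk.start n)).output := by
  obtain ⟨T, hT, hrun⟩ := run_init (P := P) (α := α) (β := β) hH hn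
  obtain ⟨T', hT', hrun'⟩ := (treeProgram k prune).run_iterate P α β hH .head N
    (fun m => ((Walk.next prune P α β)^[m] (Walk.start n)).toStore P α β) fun m hm => by
      rw [Function.iterate_succ_apply']
      exact exec_head hP (Walk.valid_iterate hP hn m) (hlt m hm)
  obtain ⟨d, -, hd, -, -, hnone⟩ := (treeProgram k prune).run_body P α β .head
    (((Walk.next prune P α β)^[N] (Walk.start n)).toStore P α β)
  have e : ((treeProgram k prune).body .head).exec .cur P α β
    (((Walk.next prune P α β)^[N] (Walk.start n)).toStore P α β) = _ := exec_head_final h3 h1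
  obtain ⟨p, hp, hfin⟩ := hnone (congrArg Prod.snd e)
  have hd' := hd.trans (hH _)
  have hall : (treeProgram k prune).toProgram.run P α β (d + (T' + T)) =
      (treeProgram k prune).conf p
        (((Walk.next prune P α β)^[N] (Walk.start n)).toStore P α β) := by
    rw [Program.run, Function.iterate_add_apply, Function.iterate_add_apply]
    refine Eq.trans (congrArg _ (congrArg _ hrun)) ?_
    refine Eq.trans (congrArg _ hrun') (hfin.trans ?_)
    exact congrArg _ (congrArg Prod.fst e)
  refine ⟨d + (T' + T), ?_, ?_, ?_, ?_⟩
  · have : H * (Nat.log 2 n + 3 + N) = H * (Nat.log 2 n + 2) + H + H * N := by ring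
    omega
  · rw [hall]
    exact (treeProgram k prune).halted_of_halt hp _
  · rw [hall]
    rfl
  · rw [hall]
    rfl

/-- At any time at most `H` steps have passed since the start of a body, where the registers are
bounded by the invariant, and each step at most doubles the number of bits. -/
theorem smallWords {K : ℕ} (hH : ∀ l, ((treeProgram k prune).body l).height ≤ H)
    (hK : ∀ l r c next, (treeProgram k prune).toProgram.instr l = .const r c next →
      Nat.size c ≤ K) (hn : 1 ≤ n) (hP : IsKDTree P) :
    (treeProgram k prune).toProgram.SmallWords P α β (2 ^ H * (K + 1 + Nat.size (k + 4))) := by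
  intro T r
  obtain ⟨N, -, -, h3, h1, hcount, -⟩ := exists_walk (α := α) (β := β) prune hn hP
  obtain ⟨l, σ, hσ, d, hd, hrun, -⟩ := (treeProgram k prune).run_invariant P α β hH
    (LoopInv prune P α β N) rfl (LoopInv.step hn hP h3 h1) T
  rw [hrun]
  set s := (K + 1 + Nat.size (k + 4)) * (Nat.log 2 n + 1) with hs
  have hsize : Nat.size n = Nat.log 2 n + 1 :=
    le_antisymm (Nat.size_le.2 (Nat.lt_pow_succ_log_self (by norm_num) n))
      (Nat.lt_size.2 (Nat.pow_log_le_self 2 (by omega)))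
  have hs1 : K + 1 + Nat.size (k + 4) ≤ s := Nat.le_mul_of_pos_right _ (by omega)
  have hs2 : Nat.log 2 n + 1 + Nat.size (k + 4) ≤ s := by
    rw [hs]
    nlinarith [Nat.zero_le (Nat.log 2 n), Nat.zero_le K, Nat.zero_le (Nat.size (k + 4)),
      Nat.zero_le (K * Nat.log 2 n), Nat.zero_le (Nat.size (k + 4) * Nat.log 2 n)]
  have hreg : ∀ r, Nat.size (((treeProgram k prune).conf
      ((treeProgram k prune).entry l) σ).reg r) ≤ s := by
    intro r
    have h := LoopInv.reg_le hn hP hcount l σ hσ r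
    refine le_trans ?_ hs2
    rw [← hsize, Nat.size_le, pow_add]
    refine lt_of_le_of_lt h (Nat.mul_lt_mul'' (Nat.lt_size_self n) (Nat.lt_size_self _))
  refine (size_iterate_le P α β (s := s) (by omega) (by omega)
    (fun l r c next h => (hK l r c next h).trans (by omega)) hreg d r).trans ?_
  rw [mul_assoc]
  exact Nat.mul_le_mul_right _ (Nat.pow_le_pow_right (by norm_num) hd)

/-- Whenever the head label is met, the machine is at the start of a round, so its store is that of
a valid walk and its tuple is `entryAt`. The factor `2` absorbs the `log n + 2` bodies of the
initialization. -/
theorem tracksTuple (hH : ∀ l, ((treeProgram k prune).body l).height ≤ H) (hn : 1 ≤ n)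
    (hP : IsKDTree P) (hQ : ∀ i, α i ≤ β i) :
    (treeProgram k prune).toProgram.TracksTuple P α β (2 * H) := by
  obtain ⟨N, -, -, h3, h1, -, -⟩ := exists_walk (α := α) (β := β) prune hn hP
  refine ⟨?_, fun T hT => ?_⟩
  · obtain ⟨T, hT, hrun⟩ := run_init (P := P) (α := α) (β := β) hH hn
    refine ⟨T, hT.trans ?_, ?_, ?_⟩
    · have : H * (Nat.log 2 n + 2) ≤ H * (2 * (Nat.log 2 n + 1)) :=
        Nat.mul_le_mul_left _ (by omega)
      linarith
    · rw [hrun]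
      rfl
    · rw [hrun]
      rfl
  · obtain ⟨l, σ, hσ, d, -, hrun, hentry⟩ := (treeProgram k prune).run_invariant P α β hH
      (LoopInv prune P α β N) rfl (LoopInv.step hn hP h3 h1) T
    obtain ⟨rfl, rfl⟩ := hentry _ hT
    obtain ⟨m, -, rfl⟩ := hσ
    have hv := Walk.valid_iterate (prune := prune) (α := α) (β := β) hP hn m
    generalize (Walk.next prune P α β)^[m] (Walk.start n) = w at hv hrun
    obtain ⟨d, hd1, hd, -, hsome, hnone⟩ := (treeProgram k prune).run_body P α β .head
      (w.toStore P α β)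
    have hadd : (treeProgram k prune).toProgram.run P α β (T + d) =
        ((treeProgram k prune).toProgram.step P α β)^[d]
          ((treeProgram k prune).toProgram.run P α β T) := by
      rw [add_comm, Program.run, Function.iterate_add_apply]
      rfl
    rw [hrun]
    refine ⟨hv.1, fun i s => isBoundaryEntry_entryAt hP hQ hv.1.1 hv.1.2 hv.2.1 i s, d, hd1,
      (hd.trans (hH _)).trans (by omega), ?_⟩
    rw [hadd, hrun]
    by_cases hfin : w.mode = 3 ∧ w.node = 1
    · have e : ((treeProgram k prune).body .head).exec .cur P α β (w.toStore P α β) = _ :=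
        exec_head_final hfin.1 hfin.2
      obtain ⟨p, hp, hend⟩ := hnone (congrArg Prod.snd e)
      left
      refine Eq.mpr (congrArg Config.Halted hend) ?_
      exact (treeProgram k prune).halted_of_halt hp _
    · have e : ((treeProgram k prune).body .head).exec .cur P α β (w.toStore P α β) = _ :=
        exec_head hP hv hfin
      have hend := (hsome .head (congrArg Prod.snd e)).trans
        (congrArg _ (congrArg Prod.fst e))
      right
      refine ⟨congrArg Config.label hend, ?_⟩
      have hnode := node_next (prune := prune) (P := P) (α := α) (β := β) w
      have hcur : (((treeProgram k prune).toProgram.step P α β)^[d]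
          ((treeProgram k prune).conf ((treeProgram k prune).entry .head)
            (w.toStore P α β))).reg Reg.cur = (w.next prune P α β).node :=
        congrArg (fun σ => Config.reg σ Reg.cur) hend
      rw [← hcur] at hnode
      exact hnode

end

/-- The programs satisfy the claims, with a constant that depends only on the dimension. The running
time is expressed by a bound `ν` for the number of nodes that are visited beyond the crossing ones. -/
theorem exists_treeProgram_bound (k : ℕ) (hk : 2 ≤ k) (prune : Bool) :
    ∃ C : ℕ, ∀ (n : ℕ) (P : Fin n → Fin k → ℝ) (α β : Fin k → ℝ),
      1 ≤ n → IsKDTree P → (∀ i, α i ≤ β i) →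
        (∃ T : ℕ, (T : ℝ) ≤ C * ((n : ℝ) ^ (1 - 1 / (k : ℝ)) +
            (if prune = true then 0 else rangeCount P α β : ℕ)) ∧
          ((treeProgram k prune).toProgram.run P α β T).Halted ∧
          ((treeProgram k prune).toProgram.run P α β T).reg Reg.out = rangeCount P α β ∧
          (prune = false → ((treeProgram k prune).toProgram.run P α β T).output.Nodup ∧
            ∀ j : Fin n, j ∈ ((treeProgram k prune).toProgram.run P α β T).output ↔
              P j ∈ Set.Icc α β)) ∧
        (treeProgram k prune).toProgram.SmallWords P α β C ∧
        (treeProgram k prune).toProgram.TracksTuple P α β C := by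
  have : NeZero k := ⟨by omega⟩
  obtain ⟨H, hH⟩ := exists_height k prune
  obtain ⟨K, hK⟩ := exists_const_bound (treeProgram k prune).toProgram
  obtain ⟨A, hA⟩ := exists_crossBound_le k hk
  -- The summands serve the running time, the word size and the tracking of the tuple.
  refine ⟨H * (8 + 20 * k) * (A + 1) + 2 ^ H * (K + 1 + Nat.size (k + 4)) + 2 * H,
    fun n P α β hn hP hQ => ⟨?_, ?_, ?_⟩⟩
  · obtain ⟨N, hN, hlt, h3, h1, hcount, hout⟩ := exists_walk (α := α) (β := β) prune hn hP
    obtain ⟨T, hT, hhalt, hreg, houtput⟩ := run_walk hH hn hP hlt h3 h1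
    refine ⟨T, ?_, hhalt, hreg.trans hcount, fun h => ?_⟩
    · set ν : ℕ := if prune = true then 0 else rangeCount P α β with hν
      have hlog := log_lt_crossBound k n
      have hvis : N ≤ 5 * (1 + 4 * k * crossBound k n + ν) := by
        refine hN.trans (Nat.mul_le_mul_left 5 ?_)
        cases prune
        · refine (sum_visited_report hP).trans ?_
          rw [sum_hit, hν, if_neg Bool.false_ne_true]
          have : 2 * k * crossBound k n ≤ 4 * k * crossBound k n :=
            Nat.mul_le_mul_right _ (by omega)
          omega
        · exact (sum_visited_count hP).trans (Nat.le_add_right _ _)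
      -- With `X = crossBound k n`, which is at least `log n + 1`, the number of bodies is at most
      -- `(X + 2) + 5 * (1 + 4 * k * X + ν)`, and `X + 7 ≤ 8 * X`.
      have hbound : T ≤ H * (8 + 20 * k) * (crossBound k n + ν) := by
        refine hT.trans ?_
        rw [mul_assoc]
        refine Nat.mul_le_mul_left H ?_
        have e : (8 + 20 * k) * (crossBound k n + ν) =
            8 * crossBound k n + 8 * ν + 5 * (4 * k * crossBound k n) + 20 * (k * ν) := by ring
        rw [e]
        omega
      have hx : (0 : ℝ) ≤ (n : ℝ) ^ (1 - 1 / (k : ℝ)) := by positivity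
      have hS := hA n hn
      calc (T : ℝ) ≤ ((H * (8 + 20 * k) * (crossBound k n + ν) : ℕ) : ℝ) := by exact_mod_cast hbound
        _ = (H * (8 + 20 * k) : ℕ) * (crossBound k n + ν : ℝ) := by push_cast; ring
        _ ≤ (H * (8 + 20 * k) : ℕ) * ((A + 1 : ℕ) * ((n : ℝ) ^ (1 - 1 / (k : ℝ)) + ν)) := by
            refine mul_le_mul_of_nonneg_left ?_ (Nat.cast_nonneg _)
            have : (0 : ℝ) ≤ A * ν := by positivity
            push_cast
            linarith
        _ = (H * (8 + 20 * k) * (A + 1) : ℕ) * ((n : ℝ) ^ (1 - 1 / (k : ℝ)) + ν) := by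
            push_cast
            ring
        _ ≤ _ := by
            refine mul_le_mul_of_nonneg_right ?_ (by positivity)
            exact_mod_cast (by omega)
    · rw [houtput]
      exact hout h
  · exact (smallWords hH hK hn hP).mono (by omega)
  · exact (tracksTuple hH hn hP hQ).mono (by omega)

end InPlaceKD

theorem mainTheorem4 (k : ℕ) (hk : 2 ≤ k) :
    (∃ (M : InPlaceKD.Program k) (C : ℕ), ∀ (n : ℕ) (P : Fin n → Fin k → ℝ) (α β : Fin k → ℝ),
      1 ≤ n → InPlaceKD.IsKDTree P → (∀ i, α i ≤ β i) →
        (∃ T : ℕ, (T : ℝ) ≤ C * (n : ℝ) ^ (1 - 1 / (k : ℝ)) ∧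
          (M.run P α β T).Halted ∧
          (M.run P α β T).reg M.out = InPlaceKD.rangeCount P α β) ∧
        M.SmallWords P α β C ∧ M.TracksTuple P α β C) ∧
    (∃ (M : InPlaceKD.Program k) (C : ℕ), ∀ (n : ℕ) (P : Fin n → Fin k → ℝ) (α β : Fin k → ℝ),
      1 ≤ n → InPlaceKD.IsKDTree P → (∀ i, α i ≤ β i) →
        (∃ T : ℕ, (T : ℝ) ≤
            C * ((n : ℝ) ^ (1 - 1 / (k : ℝ)) + (InPlaceKD.rangeCount P α β : ℝ)) ∧
          (M.run P α β T).Halted ∧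
          (M.run P α β T).output.Nodup ∧
          ∀ j : Fin n, j ∈ (M.run P α β T).output ↔ P j ∈ Set.Icc α β) ∧
        M.SmallWords P α β C ∧ M.TracksTuple P α β C) := by
  constructor
  · obtain ⟨C, hC⟩ := InPlaceKD.exists_treeProgram_bound k hk true
    refine ⟨(InPlaceKD.treeProgram k true).toProgram, C, fun n P α β hn hP hQ => ?_⟩
    obtain ⟨⟨T, hT, hhalt, hreg, -⟩, hwords, htrack⟩ := hC n P α β hn hP hQ
    refine ⟨⟨T, ?_, hhalt, hreg⟩, hwords, htrack⟩
    simpa using hT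
  · obtain ⟨C, hC⟩ := InPlaceKD.exists_treeProgram_bound k hk false
    refine ⟨(InPlaceKD.treeProgram k false).toProgram, C, fun n P α β hn hP hQ => ?_⟩
    obtain ⟨⟨T, hT, hhalt, -, hout⟩, hwords, htrack⟩ := hC n P α β hn hP hQ
    refine ⟨⟨T, ?_, hhalt, hout rfl⟩, hwords, htrack⟩
    simpa using hT
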